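/- Consider the chemical flood system $$s_t+f(s,c)_x=0,\qquad (cs+a(c))_t+(cf(s,c))_x=0,\qquad (s,c)\in[0,1]^2,$$ under the following assumptions (derivatives at end points are one-sided). Adsorption: $a\in C^2([0,1])$, $a(0)=0$, and $a_c>0$, $a_{cc}<0$ on $(0,1)$. Flow function: $f\in C^2([0,1]^2)$; for all $c\in[0,1]$: $f(0,c)=0$, $f(1,c)=1$, $f_s(0,c)=f_s(1,c)=0$, $f_s(s,c)>0$ for $0<s<1$, and there is $s^I(c)\in(0,1)$ with $f_{ss}(\cdot,c)>0$ on $(0,s^I(c))$ and $f_{ss}(\cdot,c)<0$ on $(s^I(c),1)$. There is $c^*\in(0,1)$ such that, for $0<s<1$, $f_c(s,c)<0$ if $0<c<c^*$ and $f_c(s,c)>0$ if $c^*<c<1$; moreover $f_{cc}(s^*,c^*)>0$ at the point $s^*\in(0,1]$ with $f_s(s^*,c^*)=f(s^*,c^*)/(s^*+a_c(c^*))$. Let $A:[0,1]^2\to\mathbb R$ be bounded, bounded below by a positive constant, and Lipschitz continuous. For $\kappa>0$, a shock from $u^-=(s^-,c^-)$ to $u^+=(s^+,c^+)\ne u^-$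 with velocity $v$ is called *admissible* if it satisfies the Rankine–Hugoniot conditions $v[s]=[f]$, $v[cs+a(c)]=[cf]$ and it is the limit as $\varepsilon\to0+$ of travelling wave solutions $(S,C)\big(\tfrac{x-vt}{\varepsilon}\big)$, with values in $[0,1]^2$ and $(S,C)(\pm\infty)=u^\pm$, of $$s_t+f(s,c)_x=\varepsilon_c(A(s,c)s_x)_x,\qquad (cs+a(c))_t+(cf(s,c))_x=\varepsilon_c(cA(s,c)s_x)_x+\varepsilon_d c_{xx}$$ with $\varepsilon_c=\varepsilon$, $\varepsilon_d=\kappa\varepsilon$. Let $\lambda_1\le\lambda_2$ be the characteristic speeds $\lambda^s=f_s$ and $\lambda^c=f/(s+a_c(c))$ in increasing order. A shock is of *crossing* (undercompressive) type if $\lambda_1(u^-)<v<\lambda_2(u^-)$ and $\lambda_1(u^+)<v<\lambda_2(u^+)$, and of *crossing or sonic* type if $\lambda_1(u^-)\le v<\lambda_2(u^-)$ and $\lambda_1(u^+)<v\le\lambda_2(u^+)$. **Lemma.** Let $c_L,c_R\in[0,1]$ with $c_L>c^*>c_R$. There exist $0<v_{\min}<v_{\max}<\infty$ and $\kappa_0\ge0$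 such that for every $\kappa\in(0,\infty)$ there exist unique $s^-,s^+\in[0,1]$ and $v\in[v_{\min},v_{\max}]$ for which the $c$-shock from $u^-=(s^-,c_L)$ to $u^+=(s^+,c_R)$ with velocity $v$ is admissible and of crossing or sonic type. If $v<v_{\max}$, this shock is of crossing type, and $v<v_{\max}$ holds for all $\kappa>\kappa_0$. Furthermore, let $h=\frac{a(c_L)-a(c_R)}{c_L-c_R}$, and for a state $u=(s,c)\in\{u^-,u^+\}$ let $s^K(u)$ be the point $K\in[0,1]$, $K\neq s$, with $\frac{f(K,c)}{K+h}=v$, where $s^K(u)=s$ if there is no such $K$. These values are uniquely determined, and for all $s_L,s_R$ with $s^K(u^-)\le s_L\le1$ and $0\le s_R\le s^K(u^+)$ the wave sequence $$(s_L,c_L)\xrightarrow{\,s\,}u^-\xrightarrow{\,c\text{-shock}\,}u^+\xrightarrow{\,s\,}(s_R,c_R)$$ is compatible by speed: there are $s$-wave groups (finitely many $s$-rarefactions and admissible $s$-shocks at constant $c$, in order of non-decreasing speed) from $(s_L,c_L)$ to $u^-$ with all speeds $\le v$, and from $u^+$ to $(s_R,c_R)$ with all speeds $\ge v$. Either $s$-wave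 is absent if its two states coincide. -/

import Mathlib

open Set Filter Topology

noncomputable section

namespace ChemFlood

/-! Functions of the saturation `s` and the concentration `c` live on the unit square. They are
written as functions on all of `ℝ`, but only their values on `[0,1]` are ever used; derivatives are
taken within `[0,1]`, so that they are one-sided at the end points. -/

/-- `∂q/∂s` on the unit square. -/
def dS (q : ℝ → ℝ → ℝ) (s c : ℝ) : ℝ := derivWithin (fun σ => q σ c) (Icc 0 1) s

/-- `∂q/∂c` on the unit square. -/
def dC (q : ℝ → ℝ → ℝ) (s c : ℝ) : ℝ := derivWithin (fun γ => q s γ) (Icc 0 1) c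

/-- The derivative `a_c` on `[0,1]`. -/
def dA (a : ℝ → ℝ) (c : ℝ) : ℝ := derivWithin a (Icc 0 1) c

/-- Characteristic speed `λ^s = f_s`. -/
def lamS (f : ℝ → ℝ → ℝ) (s c : ℝ) : ℝ := dS f s c

/-- Characteristic speed `λ^c = f / (s + a_c)`. -/
def lamC (f : ℝ → ℝ → ℝ) (a : ℝ → ℝ) (s c : ℝ) : ℝ := f s c / (s + dA a c)

/-- The smaller (1-family) characteristic speed. -/
def lam1 (f : ℝ → ℝ → ℝ) (a : ℝ → ℝ) (s c : ℝ) : ℝ := min (lamS f s c) (lamC f a s c)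

/-- The larger (2-family) characteristic speed. -/
def lam2 (f : ℝ → ℝ → ℝ) (a : ℝ → ℝ) (s c : ℝ) : ℝ := max (lamS f s c) (lamC f a s c)

/-- Adsorption function: `C²` on `[0,1]`, zero at zero, increasing and strictly concave. -/
structure AdsorptionAssumptions (a : ℝ → ℝ) : Prop where
  smooth : ContDiffOn ℝ 2 a (Icc 0 1)
  zero : a 0 = 0
  increasing : ∀ c ∈ Ioo (0 : ℝ) 1, 0 < dA a c
  concave : ∀ c ∈ Ioo (0 : ℝ) 1, derivWithin (dA a) (Icc 0 1) c < 0

/-- Flow function: `C²`, increasing and S-shaped in `s`, changing its monotonicity in `c` exactly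
once, at `c = cstar`. -/
structure FlowAssumptions (f : ℝ → ℝ → ℝ) (a : ℝ → ℝ) (cstar : ℝ) : Prop where
  smooth : ContDiffOn ℝ 2 (fun p : ℝ × ℝ => f p.1 p.2) (Icc 0 1 ×ˢ Icc 0 1)
  at_zero : ∀ c ∈ Icc (0 : ℝ) 1, f 0 c = 0
  at_one : ∀ c ∈ Icc (0 : ℝ) 1, f 1 c = 1
  increasing : ∀ s ∈ Ioo (0 : ℝ) 1, ∀ c ∈ Icc (0 : ℝ) 1, 0 < dS f s c
  flat_zero : ∀ c ∈ Icc (0 : ℝ) 1, dS f 0 c = 0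
  flat_one : ∀ c ∈ Icc (0 : ℝ) 1, dS f 1 c = 0
  s_shaped : ∀ c ∈ Icc (0 : ℝ) 1, ∃ sI ∈ Ioo (0 : ℝ) 1,
    (∀ s ∈ Ioo 0 sI, 0 < dS (dS f) s c) ∧ (∀ s ∈ Ioo sI 1, dS (dS f) s c < 0)
  cstar_mem : cstar ∈ Ioo (0 : ℝ) 1
  decreasing_in_c : ∀ s ∈ Ioo (0 : ℝ) 1, ∀ c ∈ Ioo 0 cstar, dC f s c < 0
  increasing_in_c : ∀ s ∈ Ioo (0 : ℝ) 1, ∀ c ∈ Ioo cstar 1, 0 < dC f s c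
  /-- `f_cc > 0` at the point of `c = cstar`, `s ≠ 0`, where the characteristic speeds coincide. -/
  nondegenerate : ∀ s ∈ Ioc (0 : ℝ) 1, dS f s cstar = f s cstar / (s + dA a cstar) →
    0 < dC (dC f) s cstar

/-- Capillary function: bounded, separated from zero and Lipschitz continuous on the square. -/
def CapillaryAssumptions (A : ℝ → ℝ → ℝ) : Prop :=
  (∃ α β : ℝ, 0 < α ∧ ∀ s ∈ Icc (0 : ℝ) 1, ∀ c ∈ Icc (0 : ℝ) 1, α ≤ A s c ∧ A s c ≤ β) ∧
  ∃ L, LipschitzOnWith L (fun p : ℝ × ℝ => A p.1 p.2) (Icc 0 1 ×ˢ Icc 0 1)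

/-- `(s, c)`, as functions of `x` and `t`, is a classical solution with values in the unit square of
`s_t + f(s,c)_x = εc (A(s,c) s_x)_x`,
`(c s + a(c))_t + (c f(s,c))_x = εc (c A(s,c) s_x)_x + εd c_xx`.
As `A` is only Lipschitz, it is the flux `A(s,c) s_x`, not `s_x`, that is differentiated in `x`. -/
structure IsDissipativeSolution (f : ℝ → ℝ → ℝ) (a : ℝ → ℝ) (A : ℝ → ℝ → ℝ) (εc εd : ℝ)
    (s c : ℝ → ℝ → ℝ) : Prop where
  s_mem : ∀ x t, s x t ∈ Icc (0 : ℝ) 1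
  c_mem : ∀ x t, c x t ∈ Icc (0 : ℝ) 1
  s_smooth : ContDiff ℝ 1 (fun p : ℝ × ℝ => s p.1 p.2)
  c_smooth : ContDiff ℝ 1 (fun p : ℝ × ℝ => c p.1 p.2)
  flux_diff : ∀ t, Differentiable ℝ (fun x => A (s x t) (c x t) * deriv (fun y => s y t) x)
  cx_diff : ∀ t, Differentiable ℝ (fun x => deriv (fun y => c y t) x)
  eq_s : ∀ x t, deriv (fun τ => s x τ) t + deriv (fun y => f (s y t) (c y t)) x
    = εc * deriv (fun y => A (s y t) (c y t) * deriv (fun z => s z t) y) x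
  eq_c : ∀ x t, deriv (fun τ => c x τ * s x τ + a (c x τ)) t
      + deriv (fun y => c y t * f (s y t) (c y t)) x
    = εc * deriv (fun y => c y t * A (s y t) (c y t) * deriv (fun z => s z t) y) x
      + εd * deriv (fun y => deriv (fun z => c z t) y) x

/-- Rankine–Hugoniot conditions `v[s] = [f]`, `v[cs + a(c)] = [c f]`. -/
def RankineHugoniot (f : ℝ → ℝ → ℝ) (a : ℝ → ℝ) (sm cm sp cp v : ℝ) : Prop :=
  v * (sp - sm) = f sp cp - f sm cm ∧
  v * ((cp * sp + a cp) - (cm * sm + a cm)) = cp * f sp cp - cm * f sm cm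

/-- Vanishing viscosity: the jump from `(sm, cm)` to `(sp, cp)` moving with velocity `v` is the
limit as `ε → 0+` of travelling waves `(S((x - vt)/ε), C((x - vt)/ε))` of the dissipative system
with `ε_c = ε`, `ε_d = κ ε`, where `(S, C)` tends to `(sm, cm)` at `-∞` and to `(sp, cp)` at `+∞`
(these boundary conditions give the convergence to the jump off the line `x = vt`). -/
def VanishingViscosity (f : ℝ → ℝ → ℝ) (a : ℝ → ℝ) (A : ℝ → ℝ → ℝ) (κ sm cm sp cp v : ℝ) : Prop :=
  ∃ S C : ℝ → ℝ,
    Tendsto S atBot (𝓝 sm) ∧ Tendsto C atBot (𝓝 cm) ∧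
    Tendsto S atTop (𝓝 sp) ∧ Tendsto C atTop (𝓝 cp) ∧
    ∀ ε : ℝ, 0 < ε → IsDissipativeSolution f a A ε (κ * ε)
      (fun x t => S ((x - v * t) / ε)) (fun x t => C ((x - v * t) / ε))

/-- A shock wave from `(sm, cm)` to `(sp, cp)` with velocity `v` that is admissible by the vanishing
viscosity criterion. It is a `c`-shock if `cm ≠ cp`, and an `s`-shock if `cm = cp`. -/
def IsAdmissibleShock (f : ℝ → ℝ → ℝ) (a : ℝ → ℝ) (A : ℝ → ℝ → ℝ) (κ sm cm sp cp v : ℝ) : Prop :=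
  (sm, cm) ≠ (sp, cp) ∧ RankineHugoniot f a sm cm sp cp v ∧
    VanishingViscosity f a A κ sm cm sp cp v

/-- Crossing (undercompressive) configuration. -/
def IsCrossing (f : ℝ → ℝ → ℝ) (a : ℝ → ℝ) (sm cm sp cp v : ℝ) : Prop :=
  (lam1 f a sm cm < v ∧ v < lam2 f a sm cm) ∧ (lam1 f a sp cp < v ∧ v < lam2 f a sp cp)

/-- Crossing configuration in which `λ₁(u⁻) = v` and `v = λ₂(u⁺)` are tolerated. -/
def IsCrossingOrSonic (f : ℝ → ℝ → ℝ) (a : ℝ → ℝ) (sm cm sp cp v : ℝ) : Prop :=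
  (lam1 f a sm cm ≤ v ∧ v < lam2 f a sm cm) ∧ (lam1 f a sp cp < v ∧ v ≤ lam2 f a sp cp)

/-- The slope `h = [a(c)]/[c]`. -/
def chordSlope (a : ℝ → ℝ) (cL cR : ℝ) : ℝ := (a cL - a cR) / (cL - cR)

/-- `K` is the critical shock value `s^K` of the state `(s, c)`: the other point of `[0,1]` at which
`f(·, c) / (· + h)` takes the value `v`, or `s` itself if there is no other such point (tangency). -/
def IsCriticalShockValue (f : ℝ → ℝ → ℝ) (h v s c K : ℝ) : Prop :=
  K ∈ Icc (0 : ℝ) 1 ∧ f K c / (K + h) = v ∧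
    (K ≠ s ∨ ∀ K' ∈ Icc (0 : ℝ) 1, f K' c / (K' + h) = v → K' = s)

/-- An `s`-rarefaction wave at constant concentration `c`: `f_s(·, c)` increases on the way from
`sl` to `sr`. -/
def IsSRarefaction (f : ℝ → ℝ → ℝ) (c sl sr : ℝ) : Prop :=
  sl ∈ Icc (0 : ℝ) 1 ∧ sr ∈ Icc (0 : ℝ) 1 ∧
  ((sl < sr ∧ StrictMonoOn (fun s => lamS f s c) (Icc sl sr)) ∨
   (sr < sl ∧ StrictAntiOn (fun s => lamS f s c) (Icc sr sl)))

/-- An `s`-wave group from `(sl, c)` to `(sr, c)`: finitely many `s`-rarefactions and admissible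
`s`-shocks in the order of non-decreasing speed. The last two arguments are the smallest and the
largest speed in the group. -/
inductive SWaveGroup (f : ℝ → ℝ → ℝ) (a : ℝ → ℝ) (A : ℝ → ℝ → ℝ) (κ c : ℝ) :
    ℝ → ℝ → ℝ → ℝ → Prop
  | rarefaction (sl sr : ℝ) (h : IsSRarefaction f c sl sr) :
      SWaveGroup f a A κ c sl sr (lamS f sl c) (lamS f sr c)
  | shock (sl sr σ : ℝ) (h : IsAdmissibleShock f a A κ sl c sr c σ) :
      SWaveGroup f a A κ c sl sr σ σ
  | comp (sl sm sr σ₁ σ₂ σ₃ σ₄ : ℝ) (h₁ : SWaveGroup f a A κ c sl sm σ₁ σ₂) (h : σ₂ ≤ σ₃)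
      (h₂ : SWaveGroup f a A κ c sm sr σ₃ σ₄) : SWaveGroup f a A κ c sl sr σ₁ σ₄

/-- The sequence `(sL, cL) —s→ (sm, cL) —c-shock of speed v→ (sp, cR) —s→ (sR, cR)` is compatible by
speed: the first `s`-wave is not faster, and the last one not slower, than the `c`-shock. Either
`s`-wave may be absent. -/
def CompatibleBySpeed (f : ℝ → ℝ → ℝ) (a : ℝ → ℝ) (A : ℝ → ℝ → ℝ)
    (κ cL cR sL sm sp sR v : ℝ) : Prop :=
  (sL = sm ∨ ∃ σ₁ σ₂, SWaveGroup f a A κ cL sL sm σ₁ σ₂ ∧ σ₂ ≤ v) ∧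
  (sp = sR ∨ ∃ σ₁ σ₂, SWaveGroup f a A κ cR sp sR σ₁ σ₂ ∧ v ≤ σ₁)

end ChemFlood

end

/-!
A travelling wave of a `c`-shock with velocity `v > 0` satisfies, after one integration and with
`h = [a]/[c]`,

`A(S, C) S' = f(S, C) - v (S + h)`,  `κ C' = -v (a(C) - a(cL) - h (C - cL))`,

and both states lie on the line `v (s + h)`. In the time `v ξ / κ` the equation for `C` contains
neither `v` nor `κ`, so `C` is, up to a shift, one fixed profile that decreases from `cL` to `cR`
(`exists_concentrationProfile`). What remains is one scalar equation for `S`, whose right-hand side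
(`reducedField`) has the sign of `f(S, C) - v (S + h)` and decreases in `v`
(`isAdmissibleShock_of_reducedWave`, `exists_reducedWave_of_isAdmissibleShock`).

As `a` is strictly concave, `λ^c > v` at `u⁻` and `λ^c < v` at `u⁺`. Hence a shock is of crossing or
sonic type exactly when `f_s(u⁻) ≤ v ≤ f_s(u⁺)` (`isCrossingOrSonic_iff`). For an S-shaped flow
function this means that `s⁻` is the last intersection of the graph of `f(·, cL)` with the line, and
`s⁺` the first one at `cR`. All such geometric facts follow from the strict quasiconcavity of
`f_s(·, c)` (`SShaped.lt_deriv`). The largest velocity for which both intersections exist is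
`vmax = min (V cL) (V cR)`, where `V c` is the maximum of `f(s, c) / (s + h)` over `s`; as `f` is
smallest at `c = c*`, `vmax` is greater than `V c*`. The number `vmin` is chosen
between `1 / (1 + h)` and `V c*`.

Existence (`exists_connection`). On `[-T, T]` a solution is made to start at `1` and to end at `0`
by the choice of `v`. For `v = vmin` it ends above `0`, because a level at which
`f(s, c) > v (s + h)` for all `c` cannot be crossed downwards. If it does so even for `v = vmax`,
one boundary condition is dropped at the side at which `vmax` is critical (`exists_shooting`). As
`T → ∞` a subsequence of these solutions converges to a solution on the whole line with values in
`[0,1]`. It tends to zeros of the limiting equations (`exists_tendsto_zero_atTop`), and barriers, or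
tangency, show that these are the last intersection at `cL` and the first one at `cR`.

Uniqueness (`velocity_le_of_connections`). If `v₁ < v₂` were two velocities, the first wave would
start above and end below the second one, but where they meet the second one has the smaller
derivative.

Large `κ` (`exists_kappa_bound`). For `v = vmax` the line lies above the graph of `f(·, c*)`, so
that `S` would fall by more than `1` while `C` is close to `c*`.

The `s`-waves follow the convex and concave envelopes of `f(·, c)`; each consists of at most one
rarefaction and one shock, whose travelling wave is a heteroclinic solution of an autonomous
equation (`exists_sWaveGroup_up`, `exists_sWaveGroup_down`). Their extreme speeds are slopes of the
graph or of its chords, which are compared with the slope `v` of the line (`compatibleBySpeed`).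
-/

namespace ChemFlood

open scoped NNReal

/-! ### Scalar differential equations on the whole line -/

/-- Existence of global solutions for a bounded vector field that is Lipschitz in space. -/
theorem exists_global_solution {G : ℝ → ℝ → ℝ} {K M : ℝ≥0} (hL : ∀ t, LipschitzWith K (G t))
    (hc : ∀ x, Continuous fun t => G t x) (hb : ∀ t x, |G t x| ≤ M) (t₀ x₀ : ℝ) :
    ∃ X : ℝ → ℝ, X t₀ = x₀ ∧ ∀ t, HasDerivAt X (G t (X t)) t := by
  -- solutions on the intervals `[t₀ - (n + 1), t₀ + (n + 1)]`, which exist because `G` is bounded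
  have loc : ∀ n : ℕ, ∃ X : ℝ → ℝ, X t₀ = x₀ ∧
      ∀ t ∈ Ioo (t₀ - (n + 1)) (t₀ + (n + 1)), HasDerivAt X (G t (X t)) t := by
    intro n
    have hn : (0 : ℝ) ≤ n := n.cast_nonneg
    have h0 : t₀ ∈ Icc (t₀ - (n + 1)) (t₀ + (n + 1)) := ⟨by linarith, by linarith⟩
    have hPL : IsPicardLindelof G (tmin := t₀ - (n + 1)) (tmax := t₀ + (n + 1)) ⟨t₀, h0⟩ x₀
        (M * (n + 1)) 0 M K :=
      { lipschitzOnWith := fun t _ => (hL t).lipschitzOnWith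
        continuousOn := fun x _ => (hc x).continuousOn
        norm_le := fun t _ x _ => hb t x
        mul_max_le := by simp }
    obtain ⟨X, hX0, hX⟩ := hPL.exists_eq_forall_mem_Icc_hasDerivWithinAt₀
    exact ⟨X, hX0, fun t ht =>
      (hX t (Ioo_subset_Icc_self ht)).hasDerivAt (Icc_mem_nhds ht.1 ht.2)⟩
  choose X hX0 hX using loc
  have agree : ∀ m n : ℕ, m ≤ n → EqOn (X m) (X n) (Ioo (t₀ - (m + 1)) (t₀ + (m + 1))) := by
    intro m n hmn
    have hmn' : (m : ℝ) ≤ n := by exact_mod_cast hmn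
    have hm : (0 : ℝ) ≤ m := m.cast_nonneg
    refine ODE_solution_unique_of_mem_Ioo (v := G) (s := fun _ => univ) (K := K) (t₀ := t₀)
      (fun t _ => (hL t).lipschitzOnWith) ⟨by linarith, by linarith⟩
      (fun t ht => ⟨hX m t ht, mem_univ _⟩)
      (fun t ht => ⟨hX n t ⟨by linarith [ht.1], by linarith [ht.2]⟩, mem_univ _⟩) ?_
    rw [hX0, hX0]
  have habs : ∀ t : ℝ, |t - t₀| < ⌈|t - t₀|⌉₊ + 1 := fun t =>
    (Nat.le_ceil _).trans_lt (lt_add_one _)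
  refine ⟨fun t => X ⌈|t - t₀|⌉₊ t, hX0 _, fun t => ?_⟩
  obtain ⟨N, hN⟩ := exists_nat_gt (|t - t₀|)
  have hmem : t ∈ Ioo (t₀ - (N + 1)) (t₀ + (N + 1)) := by
    have := abs_lt.1 (hN.trans (lt_add_one _)); constructor <;> linarith
  have key : ∀ s ∈ Ioo (t₀ - (N + 1)) (t₀ + (N + 1)), X ⌈|s - t₀|⌉₊ s = X N s := by
    intro s hs
    have h1 := abs_lt.1 (habs s)
    rcases le_total ⌈|s - t₀|⌉₊ N with h | h
    · exact agree _ _ h ⟨by linarith, by linarith⟩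
    · exact (agree _ _ h hs).symm
  have := hX N t hmem
  rw [← key t hmem] at this
  exact this.congr_of_eventuallyEq (eventually_of_mem (Ioo_mem_nhds hmem.1 hmem.2) key)

/-- Continuous dependence on the initial value and on the vector field, forwards in time. -/
theorem abs_sub_le_of_solutions_right {G H : ℝ → ℝ → ℝ} {K : ℝ≥0} (hK : 0 < K)
    (hL : ∀ t, LipschitzWith K (G t)) {X Y : ℝ → ℝ} (hX : ∀ t, HasDerivAt X (G t (X t)) t)
    (hY : ∀ t, HasDerivAt Y (H t (Y t)) t) {e δ : ℝ} (he : ∀ t x, |H t x - G t x| ≤ e) {t₀ : ℝ}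
    (h0 : |X t₀ - Y t₀| ≤ δ) {t : ℝ} (ht : t₀ ≤ t) :
    |X t - Y t| ≤ δ * Real.exp (K * (t - t₀)) + e / K * (Real.exp (K * (t - t₀)) - 1) := by
  have := dist_le_of_approx_trajectories_ODE (v := G) (K := K) (f := X) (g := Y)
    (f' := fun t => G t (X t)) (g' := fun t => H t (Y t)) (εf := 0) (εg := e) (a := t₀) (b := t)
    (δ := δ) hL
    (fun s _ => (hX s).continuousAt.continuousWithinAt) (fun s _ => (hX s).hasDerivWithinAt)
    (fun s _ => by simp) (fun s _ => (hY s).continuousAt.continuousWithinAt)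
    (fun s _ => (hY s).hasDerivWithinAt) (fun s _ => he _ _) h0 t ⟨ht, le_rfl⟩
  rw [gronwallBound_of_K_ne_0 (by exact_mod_cast hK.ne')] at this
  simpa [Real.dist_eq] using this

theorem hasDerivAt_comp_neg {X : ℝ → ℝ} {D t : ℝ} (h : HasDerivAt X D (-t)) :
    HasDerivAt (fun s => X (-s)) (-D) t := by
  simpa [Function.comp_def] using h.comp t (hasDerivAt_neg t)

/-- Continuous dependence on the initial value and on the vector field. -/
theorem abs_sub_le_of_solutions {G H : ℝ → ℝ → ℝ} {K : ℝ≥0} (hK : 0 < K)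
    (hL : ∀ t, LipschitzWith K (G t)) {X Y : ℝ → ℝ} (hX : ∀ t, HasDerivAt X (G t (X t)) t)
    (hY : ∀ t, HasDerivAt Y (H t (Y t)) t) {e δ : ℝ} (he : ∀ t x, |H t x - G t x| ≤ e) {t₀ : ℝ}
    (h0 : |X t₀ - Y t₀| ≤ δ) (t : ℝ) :
    |X t - Y t| ≤ δ * Real.exp (K * |t - t₀|) + e / K * (Real.exp (K * |t - t₀|) - 1) := by
  rcases le_total t₀ t with ht | ht
  · rw [abs_of_nonneg (sub_nonneg.2 ht)]
    exact abs_sub_le_of_solutions_right hK hL hX hY he h0 ht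
  · have := abs_sub_le_of_solutions_right (G := fun s x => -G (-s) x) (H := fun s x => -H (-s) x)
      (X := fun s => X (-s)) (Y := fun s => Y (-s)) (e := e) (δ := δ) (t₀ := -t₀) (t := -t) hK
      (fun s => (hL (-s)).neg) (fun s => hasDerivAt_comp_neg (hX (-s)))
      (fun s => hasDerivAt_comp_neg (hY (-s)))
      (fun s x => by rw [← abs_neg]; simpa [sub_eq_add_neg, add_comm] using he (-s) x)
      (by simpa using h0) (by linarith)
    rw [abs_of_nonpos (sub_nonpos.2 ht)]
    simpa [sub_eq_add_neg, add_comm] using this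

/-- A level that a function can only cross downwards is not exceeded once it is undershot. -/
theorem le_of_deriv_neg_at_level {S D : ℝ → ℝ} (hd : ∀ t, HasDerivAt S (D t) t) {l T : ℝ}
    (h0 : S T ≤ l) {b : ℝ} (hl : ∀ t, T ≤ t → t < b → S t = l → D t < 0) :
    ∀ t ∈ Icc T b, S t ≤ l := by
  intro t ht
  refine image_le_of_deriv_right_lt_deriv_boundary' (f := S) (f' := D) (a := T) (b := b)
    (B := fun _ => l) (B' := fun _ => 0)
    (fun s _ => (hd s).continuousAt.continuousWithinAt) (fun s _ => (hd s).hasDerivWithinAt)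
    h0 continuousOn_const (fun _ _ => hasDerivWithinAt_const ..)
    (fun s hs h => hl s hs.1 hs.2 h) ht

/-- A level that a function can only cross upwards is kept once it is reached. -/
theorem ge_of_deriv_pos_at_level {S D : ℝ → ℝ} (hd : ∀ t, HasDerivAt S (D t) t) {l T : ℝ}
    (h0 : l ≤ S T) {b : ℝ} (hl : ∀ t, T ≤ t → t < b → S t = l → 0 < D t) :
    ∀ t ∈ Icc T b, l ≤ S t := by
  intro t ht
  have := le_of_deriv_neg_at_level (S := fun s => -S s) (D := fun s => -D s)
    (fun s => (hd s).neg) (l := -l) (T := T) (b := b) (by simpa using h0)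
    (fun s h1 h2 h3 => by simpa using hl s h1 h2 (by simpa using h3)) t ht
  simpa using this

/-- If a function and its derivative both converge at `+∞`, the derivative tends to zero. -/
theorem deriv_limit_eq_zero {S D : ℝ → ℝ} (hd : ∀ t, HasDerivAt S (D t) t) {l m : ℝ}
    (hS : Tendsto S atTop (𝓝 l)) (hD : Tendsto D atTop (𝓝 m)) : m = 0 := by
  have h : ∀ n : ℕ, ∃ ξ ∈ Ioo (n : ℝ) (n + 1), D ξ = (S (n + 1) - S n) / ((n + 1 : ℝ) - n) :=
    fun n => exists_hasDerivAt_eq_slope S D (lt_add_one _)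
      (fun t _ => (hd t).continuousAt.continuousWithinAt) (fun t _ => hd t)
  choose ξ hξ hξe using h
  have h1 : Tendsto ξ atTop atTop :=
    tendsto_atTop_mono (fun n => (hξ n).1.le) tendsto_natCast_atTop_atTop
  have h2 : Tendsto (fun n : ℕ => S ((n : ℝ) + 1) - S n) atTop (𝓝 (l - l)) :=
    (hS.comp (tendsto_atTop_add_const_right _ 1 tendsto_natCast_atTop_atTop)).sub
      (hS.comp tendsto_natCast_atTop_atTop)
  have h3 : Tendsto (fun n => D (ξ n)) atTop (𝓝 m) := hD.comp h1
  rw [sub_self] at h2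
  refine tendsto_nhds_unique h3 (h2.congr fun n => ?_)
  rw [hξe]; simp

theorem deriv_limit_eq_zero_atBot {S D : ℝ → ℝ} (hd : ∀ t, HasDerivAt S (D t) t) {l m : ℝ}
    (hS : Tendsto S atBot (𝓝 l)) (hD : Tendsto D atBot (𝓝 m)) : m = 0 := by
  have := deriv_limit_eq_zero (S := fun t => S (-t)) (D := fun t => -D (-t))
    (fun t => hasDerivAt_comp_neg (hd (-t))) (hS.comp tendsto_neg_atTop_atBot)
    (hD.comp tendsto_neg_atTop_atBot).neg
  simpa using this

/-- A bounded solution of an asymptotically autonomous scalar equation converges to a zero of the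
limiting vector field, if these zeros are finite in number: levels that are not zeros are
eventually crossed in one direction only. -/
theorem exists_tendsto_zero_atTop {P : ℝ → ℝ → ℝ} {S C : ℝ → ℝ} {p q c : ℝ} {T : Set ℝ}
    (hP : ContinuousOn (fun z : ℝ × ℝ => P z.1 z.2) (Icc p q ×ˢ T))
    (hS : ∀ t, S t ∈ Icc p q) (hCm : ∀ t, C t ∈ T) (hc : c ∈ T) (hC : Tendsto C atTop (𝓝 c))
    (hd : ∀ t, HasDerivAt S (P (S t) (C t)) t) (hz : {s ∈ Icc p q | P s c = 0}.Finite) :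
    ∃ l ∈ Icc p q, P l c = 0 ∧ Tendsto S atTop (𝓝 l) := by
  have hlim : ∃ l, Tendsto S atTop (𝓝 l) := by
    refine tendsto_of_no_upcrossings (s := {s ∈ Icc p q | P s c = 0}ᶜ) (hz.countable.dense_compl ℝ)
      ?_ ⟨q, by simpa using ⟨0, fun t _ => (hS t).2⟩⟩ ⟨p, by simpa using ⟨0, fun t _ => (hS t).1⟩⟩
    rintro l hl b - hlb ⟨h1, h2⟩
    have hlI : l ∈ Icc p q := by
      obtain ⟨t, ht⟩ := h1.exists
      obtain ⟨t', ht'⟩ := h2.exists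
      exact ⟨by linarith [(hS t).1], by linarith [(hS t').2]⟩
    have hne : P l c ≠ 0 := fun h => hl ⟨hlI, h⟩
    have hPl : Tendsto (fun t => P l (C t)) atTop (𝓝 (P l c)) := by
      have : Tendsto (fun t => (l, C t)) atTop (𝓝[Icc p q ×ˢ T] (l, c)) :=
        tendsto_nhdsWithin_iff.2 ⟨tendsto_const_nhds.prodMk_nhds hC,
          Eventually.of_forall fun t => ⟨hlI, hCm t⟩⟩
      exact (hP (l, c) ⟨hlI, hc⟩).tendsto.comp this
    rcases lt_or_gt_of_ne hne with h | h
    · obtain ⟨t₀, ht₀⟩ := eventually_atTop.1 (hPl.eventually (gt_mem_nhds h))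
      obtain ⟨t₁, ht₁, hlt⟩ := (h1.and_eventually (eventually_ge_atTop t₀)).exists
      obtain ⟨t₂, ht₂, hgt⟩ := (h2.and_eventually (eventually_ge_atTop t₁)).exists
      have := le_of_deriv_neg_at_level hd ht₁.le (b := t₂)
        (fun t h1 _ h3 => by rw [h3]; exact ht₀ t (by linarith)) t₂ ⟨hgt, le_rfl⟩
      linarith
    · obtain ⟨t₀, ht₀⟩ := eventually_atTop.1 (hPl.eventually (lt_mem_nhds h))
      obtain ⟨t₁, ht₁, hlt⟩ := (h2.and_eventually (eventually_ge_atTop t₀)).exists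
      obtain ⟨t₂, ht₂, hgt⟩ := (h1.and_eventually (eventually_ge_atTop t₁)).exists
      have := ge_of_deriv_pos_at_level hd (hlb.trans ht₁).le (b := t₂)
        (fun t h1 _ h3 => by rw [h3]; exact ht₀ t (by linarith)) t₂ ⟨hgt, le_rfl⟩
      linarith
  obtain ⟨l, hl⟩ := hlim
  have hlI : l ∈ Icc p q := isClosed_Icc.mem_of_tendsto hl (Eventually.of_forall hS)
  refine ⟨l, hlI, ?_, hl⟩
  refine deriv_limit_eq_zero hd hl ?_
  have : Tendsto (fun t => (S t, C t)) atTop (𝓝[Icc p q ×ˢ T] (l, c)) :=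
    tendsto_nhdsWithin_iff.2 ⟨hl.prodMk_nhds hC, Eventually.of_forall fun t => ⟨hS t, hCm t⟩⟩
  exact (hP (l, c) ⟨hlI, hc⟩).tendsto.comp this

theorem exists_tendsto_zero_atBot {P : ℝ → ℝ → ℝ} {S C : ℝ → ℝ} {p q c : ℝ} {T : Set ℝ}
    (hP : ContinuousOn (fun z : ℝ × ℝ => P z.1 z.2) (Icc p q ×ˢ T))
    (hS : ∀ t, S t ∈ Icc p q) (hCm : ∀ t, C t ∈ T) (hc : c ∈ T) (hC : Tendsto C atBot (𝓝 c))
    (hd : ∀ t, HasDerivAt S (P (S t) (C t)) t) (hz : {s ∈ Icc p q | P s c = 0}.Finite) :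
    ∃ l ∈ Icc p q, P l c = 0 ∧ Tendsto S atBot (𝓝 l) := by
  obtain ⟨l, hl, h0, h⟩ := exists_tendsto_zero_atTop (P := fun s c => -P s c)
    (S := fun t => S (-t)) (C := fun t => C (-t)) hP.neg (fun t => hS _) (fun t => hCm _) hc
    (hC.comp tendsto_neg_atTop_atBot) (fun t => hasDerivAt_comp_neg (hd (-t))) (by simpa using hz)
  refine ⟨l, hl, by simpa using h0, ?_⟩
  simpa [Function.comp_def] using h.comp tendsto_neg_atBot_atTop

/-- A scalar autonomous equation has a solution that connects two neighbouring rest points. -/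
theorem exists_heteroclinic {G : ℝ → ℝ} {K : ℝ≥0} {p q x₀ : ℝ} (hL : LipschitzOnWith K G (Icc p q))
    (hp : G p = 0) (hq : G q = 0) (hpos : ∀ x ∈ Ioo p q, 0 < G x) (hx₀ : x₀ ∈ Ioo p q) :
    ∃ X : ℝ → ℝ, X 0 = x₀ ∧ (∀ t, X t ∈ Ioo p q) ∧ (∀ t, HasDerivAt X (G (X t)) t) ∧
      Tendsto X atBot (𝓝 p) ∧ Tendsto X atTop (𝓝 q) := by
  have hpq : p ≤ q := (hx₀.1.trans hx₀.2).le
  set Ĝ : ℝ → ℝ := fun x => G (projIcc p q hpq x) with hĜ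
  have hĜL : LipschitzWith K Ĝ := by
    have := (hL.to_restrict).comp (LipschitzWith.projIcc hpq)
    rwa [mul_one] at this
  obtain ⟨M, hM⟩ : ∃ M : ℝ, ∀ x ∈ Icc p q, ‖G x‖ ≤ M :=
    isCompact_Icc.exists_bound_of_continuousOn hL.continuousOn
  obtain ⟨X, hX0, hX⟩ := exists_global_solution (G := fun _ => Ĝ) (M := M.toNNReal)
    (fun _ => hĜL) (fun _ => continuous_const)
    (fun _ x => (hM _ (projIcc p q hpq x).2).trans (Real.le_coe_toNNReal M)) 0 x₀
  have huniq : ∀ r, Ĝ r = 0 → r ≠ x₀ → ∀ t, X t ≠ r := by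
    intro r hr hne t ht
    have := ODE_solution_unique_univ (v := fun _ => Ĝ) (s := fun _ => univ) (K := K) (t₀ := t)
      (f := X) (g := fun _ => r) (fun _ => hĜL.lipschitzOnWith) (fun t => ⟨hX t, mem_univ _⟩)
      (fun t => ⟨by simpa [hr] using hasDerivAt_const t r, mem_univ _⟩) ht
    exact hne (by rw [← hX0, this])
  have hXc : Continuous X := continuous_iff_continuousAt.2 fun t => (hX t).continuousAt
  have hmem : ∀ t, X t ∈ Ioo p q := by
    intro t
    constructor
    · by_contra! h
      obtain ⟨t', ht'⟩ := mem_range_of_exists_le_of_exists_ge hXc ⟨t, h⟩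
        ⟨0, by rw [hX0]; exact hx₀.1.le⟩
      exact huniq p (by simp [hĜ, hp]) hx₀.1.ne t' ht'
    · by_contra! h
      obtain ⟨t', ht'⟩ := mem_range_of_exists_le_of_exists_ge hXc
        ⟨0, by rw [hX0]; exact hx₀.2.le⟩ ⟨t, h⟩
      exact huniq q (by simp [hĜ, hq]) hx₀.2.ne' t' ht'
  have hX' : ∀ t, HasDerivAt X (G (X t)) t := by
    intro t
    have := hX t
    simp only [hĜ] at this
    rwa [projIcc_of_mem hpq (Ioo_subset_Icc_self (hmem t))] at this
  have hmono : StrictMono X := strictMono_of_deriv_pos fun t => by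
    rw [(hX' t).deriv]; exact hpos _ (hmem t)
  have hzero : ∀ l ∈ Icc p q, G l = 0 → l = p ∨ l = q := by
    intro l hl h0
    by_contra! h
    exact (hpos l ⟨lt_of_le_of_ne hl.1 h.1.symm, lt_of_le_of_ne hl.2 h.2⟩).ne' h0
  have hP : ContinuousOn (fun z : ℝ × ℝ => G z.1) (Icc p q ×ˢ (univ : Set ℝ)) :=
    hL.continuousOn.comp continuousOn_fst fun z hz => hz.1
  have hfin : {s ∈ Icc p q | G s = 0}.Finite :=
    (Set.toFinite {p, q}).subset fun l hl => by simpa using hzero l hl.1 hl.2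
  refine ⟨X, hX0, hmem, hX', ?_, ?_⟩
  · obtain ⟨l, hl, h0, h⟩ := exists_tendsto_zero_atBot (P := fun s _ => G s) (C := fun _ => 0)
      (T := univ) hP (fun t => Ioo_subset_Icc_self (hmem t)) (fun _ => mem_univ _) (mem_univ _)
      tendsto_const_nhds hX' hfin
    rcases hzero l hl h0 with rfl | rfl
    · exact h
    · exact absurd (hmono.monotone.le_of_tendsto h 0) (by rw [hX0]; exact not_le.2 hx₀.2)
  · obtain ⟨l, hl, h0, h⟩ := exists_tendsto_zero_atTop (P := fun s _ => G s) (C := fun _ => 0)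
      (T := univ) hP (fun t => Ioo_subset_Icc_self (hmem t)) (fun _ => mem_univ _) (mem_univ _)
      tendsto_const_nhds hX' hfin
    rcases hzero l hl h0 with rfl | rfl
    · exact absurd (hmono.monotone.ge_of_tendsto h 0) (by rw [hX0]; exact not_le.2 hx₀.1)
    · exact h

/-- The case of `exists_heteroclinic` in which the solution decreases. -/
theorem exists_heteroclinic_anti {G : ℝ → ℝ} {K : ℝ≥0} {p q x₀ : ℝ}
    (hL : LipschitzOnWith K G (Icc p q)) (hp : G p = 0) (hq : G q = 0)
    (hneg : ∀ x ∈ Ioo p q, G x < 0) (hx₀ : x₀ ∈ Ioo p q) :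
    ∃ X : ℝ → ℝ, X 0 = x₀ ∧ (∀ t, X t ∈ Ioo p q) ∧ (∀ t, HasDerivAt X (G (X t)) t) ∧
      Tendsto X atBot (𝓝 q) ∧ Tendsto X atTop (𝓝 p) := by
  obtain ⟨X, h0, hm, hd, hb, ht⟩ := exists_heteroclinic (G := fun x => -G x) (K := K) hL.neg
    (by simpa using hp) (by simpa using hq) (fun x hx => by simpa using hneg x hx) hx₀
  exact ⟨fun t => X (-t), by simpa using h0, fun t => hm _,
    fun t => by simpa using hasDerivAt_comp_neg (hd (-t)),
    ht.comp tendsto_neg_atBot_atTop, hb.comp tendsto_neg_atTop_atBot⟩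

/-- A quotient of Lipschitz functions is Lipschitz on a compact set on which the denominator is
bounded below by a positive constant. -/
theorem exists_lipschitzOnWith_div {E : Type*} [PseudoMetricSpace E] {u A : E → ℝ} {s : Set E}
    (hs : IsCompact s) {Ku KA : ℝ≥0} (hu : LipschitzOnWith Ku u s) (hA : LipschitzOnWith KA A s)
    {α : ℝ} (hα : 0 < α) (hAα : ∀ x ∈ s, α ≤ A x) :
    ∃ K : ℝ≥0, LipschitzOnWith K (fun x => u x / A x) s := by
  obtain ⟨M, hM⟩ := hs.exists_bound_of_continuousOn hu.continuousOn
  refine ⟨(Ku / α + M * KA / α ^ 2).toNNReal, LipschitzOnWith.of_dist_le_mul fun x hx y hy => ?_⟩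
  refine le_trans ?_ (mul_le_mul_of_nonneg_right (Real.le_coe_toNNReal _) dist_nonneg)
  have hx' := hα.trans_le (hAα x hx)
  have hy' := hα.trans_le (hAα y hy)
  have h1 : |u x - u y| ≤ Ku * dist x y := hu.dist_le_mul x hx y hy
  have h2 : |A y - A x| ≤ KA * dist x y := by
    rw [abs_sub_comm]; exact hA.dist_le_mul x hx y hy
  have hd : (0 : ℝ) ≤ dist x y := dist_nonneg
  have hMy : |u y| ≤ M := hM y hy
  have hM0 : 0 ≤ M := (abs_nonneg _).trans hMy
  have e : u x / A x - u y / A y = (u x - u y) / A x + u y * (A y - A x) / (A x * A y) := by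
    field_simp; ring
  rw [Real.dist_eq, e]
  refine (abs_add_le _ _).trans ?_
  rw [abs_div, abs_div, abs_mul, abs_mul, abs_of_pos hx', abs_of_pos hy', add_mul]
  refine add_le_add ?_ ?_
  · rw [div_mul_eq_mul_div]
    exact div_le_div₀ (by positivity) h1 hα (hAα x hx)
  · rw [div_mul_eq_mul_div, mul_assoc]
    refine div_le_div₀ (by positivity) (mul_le_mul hMy h2 (abs_nonneg _) hM0) (by positivity) ?_
    rw [sq]
    exact mul_le_mul (hAα x hx) (hAα y hy) hα.le hx'.le

/-! ### Geometry of an S-shaped function -/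

/-- An S-shaped function `φ` on `[0,1]` with derivative `φ'`, one-sided at the end points: it joins
`(0, 0)` to `(1, 1)`, where it is flat, and is strictly convex and then strictly concave. -/
structure SShaped (φ φ' : ℝ → ℝ) : Prop where
  hasDeriv : ∀ s ∈ Icc (0 : ℝ) 1, HasDerivWithinAt φ (φ' s) (Icc 0 1) s
  contDeriv : ContinuousOn φ' (Icc 0 1)
  at_zero : φ 0 = 0
  at_one : φ 1 = 1
  flat_one : φ' 1 = 0
  inflection : ∃ sI ∈ Ioo (0 : ℝ) 1, StrictMonoOn φ' (Icc 0 sI) ∧ StrictAntiOn φ' (Icc sI 1)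

namespace SShaped

variable {φ φ' : ℝ → ℝ}

theorem continuousOn (hφ : SShaped φ φ') : ContinuousOn φ (Icc 0 1) :=
  fun s hs => (hφ.hasDeriv s hs).continuousWithinAt

theorem hasDerivAt (hφ : SShaped φ φ') {s : ℝ} (hs : s ∈ Ioo (0 : ℝ) 1) : HasDerivAt φ (φ' s) s :=
  (hφ.hasDeriv s (Ioo_subset_Icc_self hs)).hasDerivAt (Icc_mem_nhds hs.1 hs.2)

theorem exists_slope (hφ : SShaped φ φ') {x y : ℝ} (hx : 0 ≤ x) (hxy : x < y) (hy : y ≤ 1) :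
    ∃ ξ ∈ Ioo x y, φ' ξ * (y - x) = φ y - φ x := by
  obtain ⟨ξ, hξ, h⟩ := exists_hasDerivAt_eq_slope φ φ' hxy
    (hφ.continuousOn.mono (Icc_subset_Icc hx hy))
    (fun s hs => hφ.hasDerivAt ⟨hx.trans_lt hs.1, hs.2.trans_le hy⟩)
  exact ⟨ξ, hξ, by rw [h, div_mul_cancel₀ _ (sub_pos.2 hxy).ne']⟩

/-- The derivative is strictly quasiconcave. All statements below on chords of `φ` follow from this
property and the mean value theorem. -/
theorem lt_deriv (hφ : SShaped φ φ') {x y z m : ℝ} (hx : 0 ≤ x) (hxy : x < y) (hyz : y < z)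
    (hz : z ≤ 1) (h1 : m ≤ φ' x) (h2 : m ≤ φ' z) : m < φ' y := by
  obtain ⟨sI, -, hm, ha⟩ := hφ.inflection
  rcases le_total y sI with h | h
  · exact h1.trans_lt (hm ⟨hx, hxy.le.trans h⟩ ⟨by linarith, h⟩ hxy)
  · exact h2.trans_lt (ha ⟨h, by linarith⟩ ⟨h.trans hyz.le, hz⟩ hyz)

/-- Left of a point where `φ` is not below the line `v (s + h)` it has a slope greater than `v`. -/
theorem exists_lt_deriv (hφ : SShaped φ φ') {v h x : ℝ} (hv : 0 < v) (hh : 0 < h) (hx0 : 0 ≤ x)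
    (hx1 : x ≤ 1) (hx : v * (x + h) ≤ φ x) : ∃ r ∈ Ioo 0 x, v < φ' r := by
  have hx0' : 0 < x := by
    rcases hx0.eq_or_lt with rfl | h0
    · rw [hφ.at_zero, zero_add] at hx
      nlinarith [mul_pos hv hh]
    · exact h0
  obtain ⟨r, hr, e⟩ := hφ.exists_slope le_rfl hx0' hx1
  refine ⟨r, hr, ?_⟩
  rw [hφ.at_zero, sub_zero, sub_zero] at e
  by_contra! hle
  nlinarith [mul_pos hv hh, mul_le_mul_of_nonneg_right hle hx0]

theorem line_lt_between (hφ : SShaped φ φ') {v h x y z : ℝ} (hv : 0 < v) (hh : 0 < h) (hx : 0 ≤ x)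
    (hxy : x < y) (hyz : y < z) (hz : z ≤ 1) (h1 : v * (x + h) ≤ φ x) (h2 : v * (z + h) ≤ φ z) :
    v * (y + h) < φ y := by
  by_contra! hle
  obtain ⟨r, hr, hr'⟩ := hφ.exists_lt_deriv hv hh hx (by linarith) h1
  obtain ⟨p, hp, hp'⟩ := hφ.exists_slope hx hxy (by linarith)
  obtain ⟨q, hq, hq'⟩ := hφ.exists_slope (by linarith) hyz hz
  have hp2 : φ' p ≤ v := by
    by_contra! hc; nlinarith [mul_lt_mul_of_pos_right hc (sub_pos.2 hxy)]
  have hq2 : v ≤ φ' q := by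
    by_contra! hc; nlinarith [mul_lt_mul_of_pos_right hc (sub_pos.2 hyz)]
  exact absurd (hφ.lt_deriv hr.1.le (hr.2.trans hp.1) (hp.2.trans hq.1) (by linarith [hq.2])
    hr'.le hq2) (not_lt.2 hp2)

/-- An intersection with the line `v (s + h)` with slope at most `v` is the last one. -/
theorem lt_line_of_deriv_le (hφ : SShaped φ φ') {v h s : ℝ} (hv : 0 < v) (hh : 0 < h) (hs : 0 ≤ s)
    (h0 : φ s = v * (s + h)) (hd : φ' s ≤ v) : ∀ z ∈ Ioc s 1, φ z < v * (z + h) := by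
  intro z hz
  by_contra! hle
  obtain ⟨r, hr, hr'⟩ := hφ.exists_lt_deriv hv hh hs (by linarith [hz.1, hz.2]) h0.ge
  obtain ⟨q, hq, hq'⟩ := hφ.exists_slope hs hz.1 hz.2
  have hq2 : v ≤ φ' q := by
    by_contra! hc; nlinarith [mul_lt_mul_of_pos_right hc (sub_pos.2 hz.1)]
  exact absurd (hφ.lt_deriv hr.1.le hr.2 hq.1 (by linarith [hq.2, hz.2]) hr'.le hq2) (not_lt.2 hd)

/-- An intersection with the line `v (s + h)` with slope at least `v` is the first one. -/
theorem lt_line_of_le_deriv (hφ : SShaped φ φ') {v h s : ℝ} (hv : 0 < v) (hh : 0 < h) (hs : s ≤ 1)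
    (h0 : φ s = v * (s + h)) (hd : v ≤ φ' s) : ∀ z ∈ Ico 0 s, φ z < v * (z + h) := by
  intro z hz
  by_contra! hle
  obtain ⟨r, hr, hr'⟩ := hφ.exists_lt_deriv hv hh hz.1 (by linarith [hz.2]) hle
  obtain ⟨p, hp, hp'⟩ := hφ.exists_slope hz.1 hz.2 hs
  have hp2 : φ' p ≤ v := by
    by_contra! hc; nlinarith [mul_lt_mul_of_pos_right hc (sub_pos.2 hz.2)]
  exact absurd (hφ.lt_deriv hr.1.le (hr.2.trans hp.1) hp.2 hs hr'.le hd) (not_lt.2 hp2)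

theorem pos_of_line (hφ : SShaped φ φ') {v h s : ℝ} (hv : 0 < v) (hh : 0 < h) (hs : 0 ≤ s)
    (h0 : φ s = v * (s + h)) : 0 < s := by
  rcases hs.eq_or_lt with rfl | h1
  · rw [hφ.at_zero, zero_add] at h0
    nlinarith [mul_pos hv hh]
  · exact h1

theorem lt_one_of_line (hφ : SShaped φ φ') {v h s : ℝ} (h1 : 1 < v * (1 + h)) (hs : s ≤ 1)
    (h0 : φ s = v * (s + h)) : s < 1 := by
  rcases hs.eq_or_lt with rfl | h1
  · rw [hφ.at_one] at h0; linarith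
  · exact h1

theorem deriv_le_of_last (hφ : SShaped φ φ') {v h s : ℝ} (hs : s ∈ Ioo (0 : ℝ) 1)
    (h0 : φ s = v * (s + h)) (hl : ∀ z ∈ Ioc s 1, φ z < v * (z + h)) : φ' s ≤ v := by
  have h1 := hasDerivWithinAt_iff_tendsto_slope' (s := Ioi s) (by simp) |>.1
    (hφ.hasDerivAt hs).hasDerivWithinAt
  refine le_of_tendsto h1 ?_
  filter_upwards [Ioc_mem_nhdsGT hs.2] with z hz
  have := hl z hz
  rw [slope_def_field, div_le_iff₀ (sub_pos.2 hz.1)]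
  linarith

theorem le_deriv_of_first (hφ : SShaped φ φ') {v h s : ℝ} (hs : s ∈ Ioo (0 : ℝ) 1)
    (h0 : φ s = v * (s + h)) (hl : ∀ z ∈ Ico 0 s, φ z < v * (z + h)) : v ≤ φ' s := by
  have h1 := hasDerivWithinAt_iff_tendsto_slope' (s := Iio s) (by simp) |>.1
    (hφ.hasDerivAt hs).hasDerivWithinAt
  refine ge_of_tendsto h1 ?_
  filter_upwards [Ico_mem_nhdsLT hs.1] with z hz
  have := hl z hz
  rw [slope_def_field, le_div_iff_of_neg (sub_neg.2 hz.2)]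
  linarith

theorem deriv_lt_of_last (hφ : SShaped φ φ') {v h s m : ℝ} (hv : 0 < v) (hh : 0 < h)
    (hs : s ∈ Ioo (0 : ℝ) 1) (h0 : φ s = v * (s + h)) (hl : ∀ z ∈ Ioc s 1, φ z < v * (z + h))
    (hm : m ∈ Icc (0 : ℝ) 1) (hm' : v * (m + h) < φ m) : φ' s < v := by
  have hms : m < s := by
    by_contra! hle
    rcases hle.eq_or_lt with rfl | hlt
    · linarith
    · linarith [hl m ⟨hlt, hm.2⟩]
  obtain ⟨r, hr, hr'⟩ := hφ.exists_lt_deriv hv hh hm.1 hm.2 hm'.le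
  obtain ⟨p, hp, hp'⟩ := hφ.exists_slope hm.1 hms hs.2.le
  have hp2 : φ' p < v := by
    by_contra! hc; nlinarith [mul_le_mul_of_nonneg_right hc (sub_pos.2 hms).le]
  by_contra! hle
  exact absurd (hφ.lt_deriv hr.1.le (hr.2.trans hp.1) hp.2 hs.2.le hr'.le hle) (not_lt.2 hp2.le)

theorem lt_deriv_of_first (hφ : SShaped φ φ') {v h s m : ℝ} (hv : 0 < v) (hh : 0 < h)
    (hs : s ∈ Ioo (0 : ℝ) 1) (h0 : φ s = v * (s + h)) (hl : ∀ z ∈ Ico 0 s, φ z < v * (z + h))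
    (hm : m ∈ Icc (0 : ℝ) 1) (hm' : v * (m + h) < φ m) : v < φ' s := by
  have hms : s < m := by
    by_contra! hle
    rcases hle.eq_or_lt with rfl | hlt
    · linarith
    · linarith [hl m ⟨hm.1, hlt⟩]
  obtain ⟨r, hr, hr'⟩ := hφ.exists_lt_deriv hv hh hs.1.le hs.2.le h0.ge
  obtain ⟨q, hq, hq'⟩ := hφ.exists_slope hs.1.le hms hm.2
  have hq2 : v ≤ φ' q := by
    by_contra! hc; nlinarith [mul_lt_mul_of_pos_right hc (sub_pos.2 hms)]
  exact hφ.lt_deriv hr.1.le hr.2 hq.1 (by linarith [hq.2, hm.2]) hr'.le hq2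

theorem finite_line (hφ : SShaped φ φ') {v h : ℝ} (hv : 0 < v) (hh : 0 < h) :
    {s ∈ Icc (0 : ℝ) 1 | φ s = v * (s + h)}.Finite := by
  by_contra hinf
  obtain ⟨t, ht, hcard⟩ := Set.Infinite.exists_subset_card_eq hinf 3
  let e := t.orderEmbOfFin hcard
  have hmem : ∀ i, e i ∈ Icc (0 : ℝ) 1 ∧ φ (e i) = v * (e i + h) := fun i =>
    ht (t.orderEmbOfFin_mem hcard i)
  have := hφ.line_lt_between hv hh (hmem 0).1.1 (e.strictMono (show (0 : Fin 3) < 1 by decide))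
    (e.strictMono (show (1 : Fin 3) < 2 by decide)) (hmem 2).1.2 (hmem 0).2.ge (hmem 2).2.ge
  exact this.ne (hmem 1).2.symm

/-- The largest value of `φ s / (s + h)` is attained in the interior. -/
theorem exists_max_slope (hφ : SShaped φ φ') {h : ℝ} (hh : 0 < h) :
    ∃ V, 0 < V ∧ 1 < V * (1 + h) ∧ (∀ s ∈ Icc (0 : ℝ) 1, φ s ≤ V * (s + h)) ∧
      ∃ s₀ ∈ Ioo (0 : ℝ) 1, φ s₀ = V * (s₀ + h) := by
  have hpos : ∀ s ∈ Icc (0 : ℝ) 1, 0 < s + h := fun s hs => by linarith [hs.1]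
  obtain ⟨s₀, hs₀, hmax⟩ := isCompact_Icc.exists_isMaxOn (f := fun s => φ s / (s + h))
    (nonempty_Icc.2 zero_le_one) (hφ.continuousOn.div (by fun_prop) fun s hs => (hpos s hs).ne')
  set V := φ s₀ / (s₀ + h) with hV
  have h0 : φ s₀ = V * (s₀ + h) := by rw [hV, div_mul_cancel₀ _ (hpos _ hs₀).ne']
  have hle : ∀ s ∈ Icc (0 : ℝ) 1, φ s ≤ V * (s + h) := fun s hs =>
    (div_le_iff₀ (hpos s hs)).1 (hmax hs)
  have h1 : 1 ≤ V * (1 + h) := by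
    simpa [hφ.at_one] using hle 1 (by simp)
  have hVpos : 0 < V := by
    by_contra! hc; nlinarith
  -- as `φ` is flat at `s = 1`, the maximum is not attained there
  have h1' : 1 < V * (1 + h) := by
    refine lt_of_le_of_ne h1 fun heq => ?_
    have := hasDerivWithinAt_iff_tendsto_slope.1 (hφ.hasDeriv 1 (by simp))
    rw [hφ.flat_one] at this
    have hne : (𝓝[Icc (0:ℝ) 1 \ {1}] 1).NeBot := by
      rw [Icc_sdiff_right]; exact mem_closure_iff_nhdsWithin_neBot.1 (by
        rw [closure_Ico zero_ne_one]; simp)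
    have h2 : V ≤ 0 := ge_of_tendsto this (by
      filter_upwards [self_mem_nhdsWithin] with z hz
      have hz1 : z < 1 := lt_of_le_of_ne hz.1.2 hz.2
      rw [slope_def_field, le_div_iff_of_neg (sub_neg.2 hz1), hφ.at_one]
      linarith [hle z hz.1])
    linarith
  exact ⟨V, hVpos, h1', hle, s₀, ⟨hφ.pos_of_line hVpos hh hs₀.1 h0, hφ.lt_one_of_line h1' hs₀.2 h0⟩,
    h0⟩

/-- A chord that leaves its left end point with at most the slope of `φ` stays below `φ`. -/
theorem chord_lt (hφ : SShaped φ φ') {x y m : ℝ} (hx : 0 ≤ x) (hy : y ≤ 1)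
    (hm : φ y = φ x + m * (y - x)) (hd : m ≤ φ' x) : ∀ s ∈ Ioo x y, φ x + m * (s - x) < φ s := by
  intro s hs
  by_contra! hle
  obtain ⟨p, hp, hp'⟩ := hφ.exists_slope hx hs.1 (by linarith [hs.2])
  obtain ⟨q, hq, hq'⟩ := hφ.exists_slope (by linarith [hs.1]) hs.2 hy
  have hp2 : φ' p ≤ m := by
    by_contra! hc; nlinarith [mul_lt_mul_of_pos_right hc (sub_pos.2 hs.1)]
  have hq2 : m ≤ φ' q := by
    by_contra! hc; nlinarith [mul_lt_mul_of_pos_right hc (sub_pos.2 hs.2)]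
  exact absurd (hφ.lt_deriv hx hp.1 (hp.2.trans hq.1) (by linarith [hq.2]) hd hq2) (not_lt.2 hp2)

/-- A chord that arrives at its right end point with at most the slope of `φ` stays above `φ`. -/
theorem lt_chord (hφ : SShaped φ φ') {x y m : ℝ} (hx : 0 ≤ x) (hy : y ≤ 1)
    (hm : φ x = φ y + m * (x - y)) (hd : m ≤ φ' y) : ∀ s ∈ Ioo x y, φ s < φ y + m * (s - y) := by
  intro s hs
  by_contra! hle
  obtain ⟨p, hp, hp'⟩ := hφ.exists_slope hx hs.1 (by linarith [hs.2])
  obtain ⟨q, hq, hq'⟩ := hφ.exists_slope (by linarith [hs.1]) hs.2 hy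
  have hp2 : m ≤ φ' p := by
    by_contra! hc; nlinarith [mul_lt_mul_of_pos_right hc (sub_pos.2 hs.1)]
  have hq2 : φ' q ≤ m := by
    by_contra! hc; nlinarith [mul_lt_mul_of_pos_right hc (sub_pos.2 hs.2)]
  exact absurd (hφ.lt_deriv (by linarith [hp.1]) (hp.2.trans hq.1) hq.2 hy hp2 hd) (not_lt.2 hq2)

/-- The lower convex envelope of `φ` on `[x, y]`: a chord, or `φ` itself, or `φ` up to a point of
tangency followed by a chord. -/
theorem convex_envelope (hφ : SShaped φ φ') {x y m : ℝ} (hx : 0 ≤ x) (hxy : x < y) (hy : y ≤ 1)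
    (hm : φ y = φ x + m * (y - x)) :
    m ≤ φ' x ∨ StrictMonoOn φ' (Icc x y) ∨
      ∃ t ∈ Ioo x y, StrictMonoOn φ' (Icc x t) ∧ φ y = φ t + φ' t * (y - t) := by
  obtain ⟨sI, hsI, hmono, hanti⟩ := hφ.inflection
  rcases le_or_gt m (φ' x) with h | hlt
  · exact Or.inl h
  right
  rcases le_or_gt y sI with h | hI
  · exact Or.inl (hmono.mono (Icc_subset_Icc hx h))
  right
  have hxI : x < sI := by
    by_contra! hle
    obtain ⟨ξ, hξ, e⟩ := hφ.exists_slope hx hxy hy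
    have := hanti ⟨hle, by linarith⟩ ⟨hle.trans hξ.1.le, by linarith [hξ.2]⟩ hξ.1
    have e2 : φ' ξ = m := mul_right_cancel₀ (sub_pos.2 hxy).ne' (by linarith)
    linarith
  have hc : ContinuousOn (fun s => φ' s * (y - s) - (φ y - φ s)) (Icc x sI) := by
    have h1 := hφ.continuousOn.mono (Icc_subset_Icc hx hsI.2.le)
    have h2 := hφ.contDeriv.mono (Icc_subset_Icc hx hsI.2.le)
    fun_prop
  obtain ⟨ξ, hξ, e⟩ := hφ.exists_slope hsI.1.le hI hy
  have h3 := hanti ⟨le_rfl, hsI.2.le⟩ ⟨hξ.1.le, by linarith [hξ.2]⟩ hξ.1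
  obtain ⟨t, ht, h0⟩ := intermediate_value_Ioo hxI.le hc (show (0 : ℝ) ∈ _ from
    ⟨by nlinarith [mul_lt_mul_of_pos_right hlt (sub_pos.2 hxy)],
      by nlinarith [mul_lt_mul_of_pos_right h3 (sub_pos.2 hI)]⟩)
  exact ⟨t, ⟨ht.1, ht.2.trans hI⟩, hmono.mono (Icc_subset_Icc hx ht.2.le), by
    simp only at h0; linarith⟩

/-- The upper concave envelope of `φ` on `[x, y]`: a chord, or `φ` itself, or a chord up to a point
of tangency followed by `φ`. -/
theorem concave_envelope (hφ : SShaped φ φ') {x y m : ℝ} (hx : 0 ≤ x) (hxy : x < y) (hy : y ≤ 1)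
    (hm : φ x = φ y + m * (x - y)) :
    m ≤ φ' y ∨ StrictAntiOn φ' (Icc x y) ∨
      ∃ t ∈ Ioo x y, StrictAntiOn φ' (Icc t y) ∧ φ x = φ t + φ' t * (x - t) := by
  obtain ⟨sI, hsI, hmono, hanti⟩ := hφ.inflection
  rcases le_or_gt m (φ' y) with h | hlt
  · exact Or.inl h
  right
  rcases le_or_gt sI x with h | hI
  · exact Or.inl (hanti.mono (Icc_subset_Icc h hy))
  right
  have hyI : sI < y := by
    by_contra! hle
    obtain ⟨ξ, hξ, e⟩ := hφ.exists_slope hx hxy hy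
    have := hmono ⟨by linarith [hξ.1], hξ.2.le.trans hle⟩ ⟨by linarith, hle⟩ hξ.2
    have e2 : φ' ξ = m := mul_right_cancel₀ (sub_pos.2 hxy).ne' (by linarith)
    linarith
  have hc : ContinuousOn (fun s => (φ s - φ x) - φ' s * (s - x)) (Icc sI y) := by
    have h1 := hφ.continuousOn.mono (Icc_subset_Icc hsI.1.le hy)
    have h2 := hφ.contDeriv.mono (Icc_subset_Icc hsI.1.le hy)
    fun_prop
  obtain ⟨ξ, hξ, e⟩ := hφ.exists_slope hx hI hsI.2.le
  have h3 := hmono ⟨by linarith [hξ.1], hξ.2.le⟩ ⟨hsI.1.le, le_rfl⟩ hξ.2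
  obtain ⟨t, ht, h0⟩ := intermediate_value_Ioo hyI.le hc (show (0 : ℝ) ∈ _ from
    ⟨by nlinarith [mul_lt_mul_of_pos_right h3 (sub_pos.2 hI)],
      by nlinarith [mul_lt_mul_of_pos_right hlt (sub_pos.2 hxy)]⟩)
  exact ⟨t, ⟨hI.trans ht.1, ht.2⟩, hanti.mono (Icc_subset_Icc ht.1.le hy), by
    simp only at h0; linarith⟩

end SShaped

/-! ### Consequences of the assumptions on the flow and adsorption functions -/

section Assumptions

variable {f : ℝ → ℝ → ℝ} {a : ℝ → ℝ} {cstar : ℝ}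

theorem derivWithin_unit_eq {g : ℝ → ℝ} {x : ℝ} (hx : x ∈ Ioo (0 : ℝ) 1) :
    derivWithin g (Icc 0 1) x = deriv g x :=
  derivWithin_of_mem_nhds (Icc_mem_nhds hx.1 hx.2)

theorem FlowAssumptions.slice (hf : FlowAssumptions f a cstar) {c : ℝ} (hc : c ∈ Icc (0 : ℝ) 1) :
    ContDiffOn ℝ 2 (fun s => f s c) (Icc 0 1) :=
  hf.smooth.comp (f := fun s : ℝ => (s, c)) (by fun_prop) fun _ hs => ⟨hs, hc⟩

theorem FlowAssumptions.sShaped (hf : FlowAssumptions f a cstar) {c : ℝ} (hc : c ∈ Icc (0 : ℝ) 1) :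
    SShaped (fun s => f s c) (fun s => dS f s c) := by
  have h2 := hf.slice hc
  have hu : UniqueDiffOn ℝ (Icc (0 : ℝ) 1) := uniqueDiffOn_Icc zero_lt_one
  have h1 : ContinuousOn (fun s => dS f s c) (Icc 0 1) :=
    h2.continuousOn_derivWithin hu (by norm_num)
  refine ⟨fun s hs => ((h2.differentiableOn (by norm_num)) s hs).hasDerivWithinAt, h1,
    hf.at_zero c hc, hf.at_one c hc, hf.flat_one c hc, ?_⟩
  obtain ⟨sI, hsI, hp, hn⟩ := hf.s_shaped c hc
  refine ⟨sI, hsI, strictMonoOn_of_deriv_pos (convex_Icc _ _)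
    (h1.mono (Icc_subset_Icc_right hsI.2.le)) fun s hs => ?_, strictAntiOn_of_deriv_neg
    (convex_Icc _ _) (h1.mono (Icc_subset_Icc_left hsI.1.le)) fun s hs => ?_⟩
  · rw [interior_Icc] at hs
    rw [← derivWithin_unit_eq ⟨hs.1, hs.2.trans hsI.2⟩]
    exact hp s hs
  · rw [interior_Icc] at hs
    rw [← derivWithin_unit_eq ⟨hsI.1.trans hs.1, hs.2⟩]
    exact hn s hs

theorem FlowAssumptions.lt_of_ne (hf : FlowAssumptions f a cstar) {s c : ℝ}
    (hs : s ∈ Ioo (0 : ℝ) 1) (hc : c ∈ Icc (0 : ℝ) 1) (hne : c ≠ cstar) : f s cstar < f s c := by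
  have hcont : ContinuousOn (fun γ => f s γ) (Icc 0 1) :=
    hf.smooth.continuousOn.comp (f := fun γ : ℝ => (s, γ)) (by fun_prop)
      fun _ hγ => ⟨Ioo_subset_Icc_self hs, hγ⟩
  have hst := hf.cstar_mem
  rcases lt_or_gt_of_ne hne with h | h
  · refine strictAntiOn_of_deriv_neg (convex_Icc 0 cstar)
      (hcont.mono (Icc_subset_Icc_right hst.2.le)) (fun γ hγ => ?_) ⟨hc.1, h.le⟩
      ⟨hst.1.le, le_rfl⟩ h
    rw [interior_Icc] at hγ
    rw [← derivWithin_unit_eq ⟨hγ.1, hγ.2.trans hst.2⟩]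
    exact hf.decreasing_in_c s hs γ hγ
  · refine strictMonoOn_of_deriv_pos (convex_Icc cstar 1)
      (hcont.mono (Icc_subset_Icc_left hst.1.le)) (fun γ hγ => ?_) ⟨le_rfl, hst.2.le⟩
      ⟨h.le, hc.2⟩ h
    rw [interior_Icc] at hγ
    rw [← derivWithin_unit_eq ⟨hst.1.trans hγ.1, hγ.2⟩]
    exact hf.increasing_in_c s hs γ hγ

theorem AdsorptionAssumptions.hasDerivAt (ha : AdsorptionAssumptions a) {c : ℝ}
    (hc : c ∈ Ioo (0 : ℝ) 1) : HasDerivAt a (dA a c) c :=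
  ((ha.smooth.differentiableOn (by norm_num)) c
    (Ioo_subset_Icc_self hc)).hasDerivWithinAt.hasDerivAt (Icc_mem_nhds hc.1 hc.2)

theorem AdsorptionAssumptions.strictAntiOn (ha : AdsorptionAssumptions a) :
    StrictAntiOn (dA a) (Icc 0 1) := by
  refine strictAntiOn_of_deriv_neg (convex_Icc _ _) (ha.smooth.continuousOn_derivWithin
    (uniqueDiffOn_Icc zero_lt_one) (by norm_num)) fun c hc => ?_
  rw [interior_Icc] at hc
  rw [← derivWithin_unit_eq hc]
  exact ha.concave c hc

theorem AdsorptionAssumptions.exists_slope (ha : AdsorptionAssumptions a) {x y : ℝ} (hx : 0 ≤ x)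
    (hxy : x < y) (hy : y ≤ 1) : ∃ ξ ∈ Ioo x y, dA a ξ * (y - x) = a y - a x := by
  obtain ⟨ξ, hξ, h⟩ := exists_hasDerivAt_eq_slope a (dA a) hxy
    (ha.smooth.continuousOn.mono (Icc_subset_Icc hx hy))
    (fun s hs => ha.hasDerivAt ⟨hx.trans_lt hs.1, hs.2.trans_le hy⟩)
  exact ⟨ξ, hξ, by rw [h, div_mul_cancel₀ _ (sub_pos.2 hxy).ne']⟩

theorem AdsorptionAssumptions.dA_nonneg (ha : AdsorptionAssumptions a) {c : ℝ} : 0 ≤ dA a c := by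
  refine MonotoneOn.derivWithin_nonneg (StrictMonoOn.monotoneOn ?_)
  refine strictMonoOn_of_deriv_pos (convex_Icc _ _) ha.smooth.continuousOn fun c hc => ?_
  rw [interior_Icc] at hc
  rw [← derivWithin_unit_eq hc]
  exact ha.increasing c hc

/-- The gap between the concave function `a` and its chord over `[cR, cL]`. The concentration in a
travelling wave satisfies `κ C' = -v chordGap(C)`. -/
noncomputable def chordGap (a : ℝ → ℝ) (cL cR c : ℝ) : ℝ :=
  a c - a cL - chordSlope a cL cR * (c - cL)

variable {cL cR : ℝ}

theorem chordSlope_mul (hlt : cR < cL) : chordSlope a cL cR * (cL - cR) = a cL - a cR :=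
  div_mul_cancel₀ _ (sub_pos.2 hlt).ne'

theorem chordGap_left : chordGap a cL cR cL = 0 := by simp [chordGap]

theorem chordGap_right (hlt : cR < cL) : chordGap a cL cR cR = 0 := by
  have := chordSlope_mul (a := a) hlt
  unfold chordGap; linarith

theorem AdsorptionAssumptions.slopes (ha : AdsorptionAssumptions a) (hL : cL ≤ 1) (hR : 0 ≤ cR)
    (hlt : cR < cL) : 0 < chordSlope a cL cR ∧ dA a cL < chordSlope a cL cR ∧
      chordSlope a cL cR < dA a cR := by
  obtain ⟨ξ, hξ, e⟩ := ha.exists_slope hR hlt hL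
  have e2 : chordSlope a cL cR = dA a ξ :=
    mul_right_cancel₀ (sub_pos.2 hlt).ne' (by rw [e, chordSlope_mul hlt])
  have hξ' : ξ ∈ Ioo (0 : ℝ) 1 := ⟨hR.trans_lt hξ.1, hξ.2.trans_le hL⟩
  rw [e2]
  exact ⟨ha.increasing ξ hξ', ha.strictAntiOn (Ioo_subset_Icc_self hξ') ⟨by linarith, hL⟩ hξ.2,
    ha.strictAntiOn ⟨hR, by linarith⟩ (Ioo_subset_Icc_self hξ') hξ.1⟩

theorem AdsorptionAssumptions.chordGap_pos (ha : AdsorptionAssumptions a) (hL : cL ≤ 1)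
    (hR : 0 ≤ cR) (hlt : cR < cL) {c : ℝ} (hc : c ∈ Ioo cR cL) : 0 < chordGap a cL cR c := by
  obtain ⟨ξ, hξ, e⟩ := ha.exists_slope hR hc.1 (by linarith [hc.2])
  obtain ⟨η, hη, e'⟩ := ha.exists_slope (by linarith [hc.1]) hc.2 hL
  have h1 := ha.strictAntiOn ⟨by linarith [hξ.1], by linarith [hξ.2, hc.2]⟩
    ⟨by linarith [hη.1, hc.1], by linarith [hη.2]⟩ (hξ.2.trans hη.1)
  have h2 := chordSlope_mul (a := a) hlt
  -- the slope of the chord is a weighted mean of the slopes left and right of `c`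
  have h3 : dA a η < chordSlope a cL cR := by
    by_contra! hle
    nlinarith [mul_le_mul_of_nonneg_right hle (sub_pos.2 hlt).le,
      mul_lt_mul_of_pos_right h1 (sub_pos.2 hc.1)]
  unfold chordGap
  nlinarith [mul_lt_mul_of_pos_right h3 (sub_pos.2 hc.2)]

end Assumptions

/-! ### Travelling waves as solutions of ordinary differential equations -/

section TravellingWaves

variable {f : ℝ → ℝ → ℝ} {a : ℝ → ℝ} {A : ℝ → ℝ → ℝ} {cstar : ℝ}

theorem exists_lipschitz_field (hf : FlowAssumptions f a cstar) (hA : CapillaryAssumptions A)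
    (v k : ℝ) : ∃ K : ℝ≥0, LipschitzOnWith K
      (fun p : ℝ × ℝ => (f p.1 p.2 - v * p.1 - k) / A p.1 p.2) (Icc 0 1 ×ˢ Icc 0 1) := by
  obtain ⟨⟨α, β, hα, hAα⟩, L, hL⟩ := hA
  have hcomp : IsCompact (Icc (0 : ℝ) 1 ×ˢ Icc (0 : ℝ) 1) := isCompact_Icc.prod isCompact_Icc
  have hsm : ContDiffOn ℝ 2 (fun p : ℝ × ℝ => f p.1 p.2 - v * p.1 - k) (Icc 0 1 ×ˢ Icc 0 1) :=
    (hf.smooth.sub (by fun_prop)).sub (by fun_prop)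
  obtain ⟨Ku, hu⟩ := hsm.exists_lipschitzOnWith (by norm_num)
    ((convex_Icc _ _).prod (convex_Icc _ _)) hcomp
  exact exists_lipschitzOnWith_div hcomp hu hL hα fun p hp => (hAα p.1 hp.1 p.2 hp.2).1

theorem CapillaryAssumptions.pos (hA : CapillaryAssumptions A) {s c : ℝ} (hs : s ∈ Icc (0 : ℝ) 1)
    (hc : c ∈ Icc (0 : ℝ) 1) : 0 < A s c := by
  obtain ⟨⟨α, β, hα, hAα⟩, -⟩ := hA
  exact hα.trans_le (hAα s hs c hc).1

theorem CapillaryAssumptions.continuousOn (hA : CapillaryAssumptions A) :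
    ContinuousOn (fun p : ℝ × ℝ => A p.1 p.2) (Icc 0 1 ×ˢ Icc 0 1) := by
  obtain ⟨-, L, hL⟩ := hA
  exact hL.continuousOn

theorem FlowAssumptions.differentiable_comp (hf : FlowAssumptions f a cstar) {S C : ℝ → ℝ}
    (hS : ∀ t, S t ∈ Icc (0 : ℝ) 1) (hC : ∀ t, C t ∈ Icc (0 : ℝ) 1) (hdS : Differentiable ℝ S)
    (hdC : Differentiable ℝ C) : Differentiable ℝ fun t => f (S t) (C t) := by
  intro t
  have h1 : DifferentiableWithinAt ℝ (fun t => (S t, C t)) univ t :=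
    ((hdS t).prodMk (hdC t)).differentiableWithinAt
  have h2 : MapsTo (fun t => (S t, C t)) univ (Icc (0 : ℝ) 1 ×ˢ Icc (0 : ℝ) 1) :=
    fun t _ => ⟨hS t, hC t⟩
  have := ((hf.smooth.differentiableOn (by norm_num)) (S t, C t) ⟨hS t, hC t⟩).comp t h1 h2
  rwa [differentiableWithinAt_univ] at this

theorem AdsorptionAssumptions.differentiable_comp (ha : AdsorptionAssumptions a) {C : ℝ → ℝ}
    (hC : ∀ t, C t ∈ Icc (0 : ℝ) 1) (hdC : Differentiable ℝ C) :
    Differentiable ℝ fun t => a (C t) := by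
  intro t
  have := ((ha.smooth.differentiableOn (by norm_num)) (C t) (hC t)).comp t
    (hdC t).differentiableWithinAt (s := univ) fun t _ => hC t
  rwa [differentiableWithinAt_univ] at this

theorem hasDerivAt_wave_x {g : ℝ → ℝ} {g' v ε x t : ℝ} (h : HasDerivAt g g' ((x - v * t) / ε)) :
    HasDerivAt (fun y => g ((y - v * t) / ε)) (g' / ε) x := by
  have h1 : HasDerivAt (fun y : ℝ => (y - v * t) / ε) (1 / ε) x :=
    ((hasDerivAt_id x).sub_const _).div_const _
  simpa [Function.comp_def, div_eq_mul_inv] using h.comp x h1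

theorem hasDerivAt_wave_t {g : ℝ → ℝ} {g' v ε x t : ℝ} (h : HasDerivAt g g' ((x - v * t) / ε)) :
    HasDerivAt (fun τ => g ((x - v * τ) / ε)) (-v * g' / ε) t := by
  have h1 : HasDerivAt (fun τ : ℝ => (x - v * τ) / ε) (-v / ε) t := by
    have := (((hasDerivAt_id t).const_mul v).const_sub x).div_const ε
    simpa using this
  have := h.comp t h1
  simp only [Function.comp_def] at this
  exact this.congr_deriv (by ring)

/-- Solutions of the integrated travelling wave equations, in which `k` and `m` are the constants of
integration, are travelling wave solutions of the dissipative system for every `ε`. -/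
theorem isDissipativeSolution_of_ode (hf : FlowAssumptions f a cstar)
    (ha : AdsorptionAssumptions a) (hA : CapillaryAssumptions A) {κ v k m : ℝ} (hκ : 0 < κ)
    {S C : ℝ → ℝ} (hS : ∀ t, S t ∈ Icc (0 : ℝ) 1) (hC : ∀ t, C t ∈ Icc (0 : ℝ) 1)
    (hS' : ∀ t, HasDerivAt S ((f (S t) (C t) - v * S t - k) / A (S t) (C t)) t)
    (hC' : ∀ t, HasDerivAt C ((k * C t - v * a (C t) + m) / κ) t) {ε : ℝ} (hε : 0 < ε) :
    IsDissipativeSolution f a A ε (κ * ε)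
      (fun x t => S ((x - v * t) / ε)) (fun x t => C ((x - v * t) / ε)) := by
  have hdS : Differentiable ℝ S := fun t => (hS' t).differentiableAt
  have hdC : Differentiable ℝ C := fun t => (hC' t).differentiableAt
  have hApos : ∀ t, 0 < A (S t) (C t) := fun t => hA.pos (hS t) (hC t)
  have hF := hf.differentiable_comp hS hC hdS hdC
  have haC := ha.differentiable_comp hC hdC
  have hAc : Continuous fun t => A (S t) (C t) :=
    hA.continuousOn.comp_continuous (hdS.continuous.prodMk hdC.continuous) fun t => ⟨hS t, hC t⟩
  set F : ℝ → ℝ := fun t => f (S t) (C t) with hFdef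
  set W : ℝ → ℝ := fun t => F t - v * S t - k with hW
  set Z : ℝ → ℝ := fun t => (k * C t - v * a (C t) + m) / κ with hZ
  have hS1 : ContDiff ℝ 1 S := contDiff_one_iff_deriv.2 ⟨hdS, by
    rw [show deriv S = fun t => W t / A (S t) (C t) from funext fun t => (hS' t).deriv]
    exact ((hF.continuous.sub (hdS.continuous.const_mul v)).sub continuous_const).div hAc
      fun t => (hApos t).ne'⟩
  have hC1 : ContDiff ℝ 1 C := contDiff_one_iff_deriv.2 ⟨hdC, by
    rw [show deriv C = Z from funext fun t => (hC' t).deriv]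
    exact (((hdC.continuous.const_mul k).sub (haC.continuous.const_mul v)).add
      continuous_const).div_const κ⟩
  have hW' : ∀ t, HasDerivAt W (deriv F t - v * (W t / A (S t) (C t))) t := fun t =>
    (((hF t).hasDerivAt).sub ((hS' t).const_mul v)).sub_const k
  have hZ' : ∀ t, HasDerivAt Z ((k * Z t - v * deriv (fun t => a (C t)) t) / κ) t := fun t =>
    ((((hC' t).const_mul k).sub ((haC t).hasDerivAt.const_mul v)).add_const m).div_const κ
  have hsx : ∀ x t, deriv (fun y => S ((y - v * t) / ε)) x
      = W ((x - v * t) / ε) / A (S ((x - v * t) / ε)) (C ((x - v * t) / ε)) / ε :=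
    fun x t => (hasDerivAt_wave_x (hS' _)).deriv
  have hcx : ∀ t, (fun x => deriv (fun y => C ((y - v * t) / ε)) x)
      = fun x => Z ((x - v * t) / ε) / ε :=
    fun t => funext fun x => (hasDerivAt_wave_x (hC' _)).deriv
  have hflux : ∀ t, (fun x => A (S ((x - v * t) / ε)) (C ((x - v * t) / ε)) *
      deriv (fun y => S ((y - v * t) / ε)) x) = fun x => W ((x - v * t) / ε) / ε := by
    intro t; funext x
    rw [hsx]
    have := (hApos ((x - v * t) / ε)).ne'
    field_simp
  have hflux' : ∀ x t, HasDerivAt (fun x => W ((x - v * t) / ε) / ε) _ x := fun x t =>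
    (hasDerivAt_wave_x (hW' ((x - v * t) / ε))).div_const ε
  have hcflux : ∀ t, (fun x => C ((x - v * t) / ε) * A (S ((x - v * t) / ε)) (C ((x - v * t) / ε)) *
      deriv (fun y => S ((y - v * t) / ε)) x)
      = fun x => C ((x - v * t) / ε) * (W ((x - v * t) / ε) / ε) := by
    intro t; funext x
    rw [mul_assoc, congrFun (hflux t) x]
  have hcxx : ∀ x t, HasDerivAt (fun x => Z ((x - v * t) / ε) / ε) _ x := fun x t =>
    (hasDerivAt_wave_x (hZ' ((x - v * t) / ε))).div_const ε
  refine ⟨fun _ _ => hS _, fun _ _ => hC _, hS1.comp (by fun_prop), hC1.comp (by fun_prop),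
    fun t => ?_, fun t => ?_, fun x t => ?_, fun x t => ?_⟩
  · simp only [hflux t]
    exact fun x => (hflux' x t).differentiableAt
  · rw [hcx t]
    exact fun x => (hcxx x t).differentiableAt
  · rw [hflux t, (hflux' x t).deriv, (hasDerivAt_wave_t (hS' _)).deriv,
      (hasDerivAt_wave_x (g := F) (hF _).hasDerivAt).deriv]
    field_simp
    ring
  · have h1 : HasDerivAt (fun τ => C ((x - v * τ) / ε) * S ((x - v * τ) / ε)
        + a (C ((x - v * τ) / ε))) _ t :=
      ((hasDerivAt_wave_t (hC' _)).mul (hasDerivAt_wave_t (hS' _))).add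
        (hasDerivAt_wave_t (g := fun t => a (C t)) (haC _).hasDerivAt)
    have h2 : HasDerivAt (fun y => C ((y - v * t) / ε) *
        f (S ((y - v * t) / ε)) (C ((y - v * t) / ε))) _ x :=
      (hasDerivAt_wave_x (hC' _)).mul (hasDerivAt_wave_x (g := F) (hF _).hasDerivAt)
    have h3 : HasDerivAt (fun x => C ((x - v * t) / ε) * (W ((x - v * t) / ε) / ε)) _ x :=
      (hasDerivAt_wave_x (hC' _)).mul (hflux' x t)
    rw [hcflux t, hcx t, h1.deriv, h2.deriv, h3.deriv, (hcxx x t).deriv]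
    have := (hApos ((x - v * t) / ε)).ne'
    simp only [hW, hZ, hFdef]
    field_simp
    ring

/-- The converse of `isDissipativeSolution_of_ode` for waves that connect two constant states;
these states determine the constants of integration. -/
theorem ode_of_isDissipativeSolution (hf : FlowAssumptions f a cstar)
    (ha : AdsorptionAssumptions a) (hA : CapillaryAssumptions A) {κ v sm cm : ℝ} (hκ : 0 < κ)
    {S C : ℝ → ℝ} (hsm : sm ∈ Icc (0 : ℝ) 1) (hcm : cm ∈ Icc (0 : ℝ) 1)
    (hSb : Tendsto S atBot (𝓝 sm)) (hCb : Tendsto C atBot (𝓝 cm))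
    (h : IsDissipativeSolution f a A 1 (κ * 1)
      (fun x t => S ((x - v * t) / 1)) (fun x t => C ((x - v * t) / 1))) :
    (∀ t, S t ∈ Icc (0 : ℝ) 1) ∧ (∀ t, C t ∈ Icc (0 : ℝ) 1) ∧
      (∀ t, HasDerivAt S ((f (S t) (C t) - v * S t - (f sm cm - v * sm)) / A (S t) (C t)) t) ∧
      ∀ t, HasDerivAt C (((f sm cm - v * sm) * (C t - cm) - v * (a (C t) - a cm)) / κ) t := by
  have hS : ∀ t, S t ∈ Icc (0 : ℝ) 1 := fun t => by simpa using h.s_mem t 0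
  have hC : ∀ t, C t ∈ Icc (0 : ℝ) 1 := fun t => by simpa using h.c_mem t 0
  have hS1 : ContDiff ℝ 1 S := by
    have := h.s_smooth.comp (f := fun x : ℝ => (x, (0 : ℝ))) (by fun_prop)
    simpa [Function.comp_def] using this
  have hC1 : ContDiff ℝ 1 C := by
    have := h.c_smooth.comp (f := fun x : ℝ => (x, (0 : ℝ))) (by fun_prop)
    simpa [Function.comp_def] using this
  have hdS : Differentiable ℝ S := hS1.differentiable (by norm_num)
  have hdC : Differentiable ℝ C := hC1.differentiable (by norm_num)
  have hApos : ∀ t, 0 < A (S t) (C t) := fun t => hA.pos (hS t) (hC t)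
  have hF := hf.differentiable_comp hS hC hdS hdC
  have haC := ha.differentiable_comp hC hdC
  have hflux : Differentiable ℝ fun x => A (S x) (C x) * deriv S x := by
    simpa using h.flux_diff 0
  have hcxd : Differentiable ℝ fun x => deriv C x := by simpa using h.cx_diff 0
  have hst : ∀ x, deriv (fun τ => S (x - v * τ)) 0 = -v * deriv S x := fun x => by
    simpa using (hasDerivAt_wave_t (v := v) (ε := 1) (x := x) (t := 0) (g := S)
      (hdS _).hasDerivAt).deriv
  have hct : ∀ x, deriv (fun τ => C (x - v * τ) * S (x - v * τ) + a (C (x - v * τ))) 0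
      = -v * deriv (fun y => C y * S y + a (C y)) x := fun x => by
    simpa [Pi.add_def, Pi.mul_def] using (hasDerivAt_wave_t (v := v) (ε := 1) (x := x) (t := 0)
      (g := fun y => C y * S y + a (C y)) (((hdC.mul hdS).add haC) _).hasDerivAt).deriv
  have e1 : ∀ x, -v * deriv S x + deriv (fun y => f (S y) (C y)) x
      = deriv (fun y => A (S y) (C y) * deriv S y) x := fun x => by
    rw [← hst]; simpa using h.eq_s x 0
  have e2 : ∀ x, -v * deriv (fun y => C y * S y + a (C y)) x
      + deriv (fun y => C y * f (S y) (C y)) x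
      = deriv (fun y => C y * A (S y) (C y) * deriv S y) x + κ * deriv (fun y => deriv C y) x :=
    fun x => by rw [← hct]; simpa using h.eq_c x 0
  have hcflux : Differentiable ℝ fun y => C y * A (S y) (C y) * deriv S y := by
    simpa only [mul_assoc, Pi.mul_def] using hdC.mul hflux
  -- both equations are integrated once
  obtain ⟨k, hk⟩ : ∃ k, ∀ x, A (S x) (C x) * deriv S x - f (S x) (C x) + v * S x = -k := by
    refine ⟨-(A (S 0) (C 0) * deriv S 0 - f (S 0) (C 0) + v * S 0), fun x => ?_⟩
    rw [neg_neg]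
    refine is_const_of_deriv_eq_zero (f := fun x => A (S x) (C x) * deriv S x - f (S x) (C x)
      + v * S x) ((hflux.sub hF).add (hdS.const_mul v)) (fun x => ?_) x 0
    have := (((hflux x).hasDerivAt.sub (hF x).hasDerivAt).add
      ((hdS x).hasDerivAt.const_mul v)).deriv
    refine this.trans ?_
    linarith [e1 x]
  obtain ⟨m, hm⟩ : ∃ m, ∀ x, C x * A (S x) (C x) * deriv S x + κ * deriv C x
      - C x * f (S x) (C x) + v * (C x * S x + a (C x)) = m := by
    refine ⟨_, fun x => is_const_of_deriv_eq_zero (f := fun x => C x * A (S x) (C x) * deriv S x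
      + κ * deriv C x - C x * f (S x) (C x) + v * (C x * S x + a (C x)))
      (((hcflux.add (hcxd.const_mul κ)).sub (hdC.mul hF)).add
        (((hdC.mul hdS).add haC).const_mul v)) (fun x => ?_) x 0⟩
    have := ((((hcflux x).hasDerivAt.add ((hcxd x).hasDerivAt.const_mul κ)).sub
      ((hdC.mul hF) x).hasDerivAt).add (((hdC.mul hdS).add haC) x |>.hasDerivAt.const_mul v)).deriv
    refine this.trans ?_
    have := e2 x
    simp only [Pi.mul_def, Pi.add_def] at this ⊢
    linarith
  have hS' : ∀ t, HasDerivAt S ((f (S t) (C t) - v * S t - k) / A (S t) (C t)) t := fun t => by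
    have : deriv S t = (f (S t) (C t) - v * S t - k) / A (S t) (C t) := by
      rw [eq_div_iff (hApos t).ne']; linarith [hk t]
    rw [← this]; exact (hdS t).hasDerivAt
  have hC' : ∀ t, HasDerivAt C ((k * C t - v * a (C t) + m) / κ) t := fun t => by
    have : deriv C t = (k * C t - v * a (C t) + m) / κ := by
      rw [eq_div_iff hκ.ne']
      linear_combination hm t - C t * hk t
    rw [← this]; exact (hdC t).hasDerivAt
  -- the constants of integration are read off at `-∞`, where the derivatives vanish
  have hlim : Tendsto (fun t => (S t, C t)) atBot (𝓝[Icc 0 1 ×ˢ Icc 0 1] (sm, cm)) :=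
    tendsto_nhdsWithin_iff.2 ⟨hSb.prodMk_nhds hCb, Eventually.of_forall fun t => ⟨hS t, hC t⟩⟩
  have hflim : Tendsto (fun t => f (S t) (C t)) atBot (𝓝 (f sm cm)) :=
    (hf.smooth.continuousOn (sm, cm) ⟨hsm, hcm⟩).tendsto.comp hlim
  have hAlim : Tendsto (fun t => A (S t) (C t)) atBot (𝓝 (A sm cm)) :=
    (hA.continuousOn (sm, cm) ⟨hsm, hcm⟩).tendsto.comp hlim
  have halim : Tendsto (fun t => a (C t)) atBot (𝓝 (a cm)) :=
    (ha.smooth.continuousOn cm hcm).tendsto.comp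
      (tendsto_nhdsWithin_iff.2 ⟨hCb, Eventually.of_forall hC⟩)
  have h1 := deriv_limit_eq_zero_atBot hS' hSb
    (((hflim.sub (hSb.const_mul v)).sub_const k).div hAlim (hA.pos hsm hcm).ne')
  have hk0 : k = f sm cm - v * sm := by
    rcases div_eq_zero_iff.1 h1 with h | h
    · linarith
    · exact absurd h (hA.pos hsm hcm).ne'
  have h2 := deriv_limit_eq_zero_atBot hC' hCb
    ((((hCb.const_mul k).sub (halim.const_mul v)).add_const m).div_const κ)
  have hm0 : m = v * a cm - k * cm := by
    rcases div_eq_zero_iff.1 h2 with h | h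
    · linarith
    · exact absurd h hκ.ne'
  refine ⟨hS, hC, fun t => ?_, fun t => ?_⟩
  · rw [← hk0]; exact hS' t
  · rw [← hk0]; convert hC' t using 2; rw [hm0]; ring

end TravellingWaves

/-! ### Shocks and wave groups at constant concentration -/

section SWaves

variable {f : ℝ → ℝ → ℝ} {a : ℝ → ℝ} {A : ℝ → ℝ → ℝ} {cstar : ℝ}

theorem exists_lipschitz_slice (hf : FlowAssumptions f a cstar) (hA : CapillaryAssumptions A)
    {c x y : ℝ} (hc : c ∈ Icc (0 : ℝ) 1) (hx : 0 ≤ x) (hy : y ≤ 1) (v k : ℝ) :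
    ∃ K : ℝ≥0, LipschitzOnWith K (fun s => (f s c - v * s - k) / A s c) (Icc x y) := by
  obtain ⟨K, hK⟩ := exists_lipschitz_field hf hA v k
  refine ⟨K, LipschitzOnWith.of_dist_le_mul fun s hs t ht => ?_⟩
  have := hK.dist_le_mul (s, c) ⟨⟨hx.trans hs.1, hs.2.trans hy⟩, hc⟩ (t, c)
    ⟨⟨hx.trans ht.1, ht.2.trans hy⟩, hc⟩
  simpa [Prod.dist_eq] using this

/-- A heteroclinic solution of the travelling wave equation at constant concentration makes an
`s`-shock admissible. -/
theorem isAdmissibleShock_of_heteroclinic (hf : FlowAssumptions f a cstar)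
    (ha : AdsorptionAssumptions a) (hA : CapillaryAssumptions A) {κ c sl sr σ : ℝ} (hκ : 0 < κ)
    (hc : c ∈ Icc (0 : ℝ) 1) (hne : sl ≠ sr) (hσ : f sr c = f sl c + σ * (sr - sl))
    (hS : ∃ S : ℝ → ℝ, (∀ t, S t ∈ Icc (0 : ℝ) 1) ∧
      (∀ t, HasDerivAt S ((f (S t) c - σ * S t - (f sl c - σ * sl)) / A (S t) c) t) ∧
      Tendsto S atBot (𝓝 sl) ∧ Tendsto S atTop (𝓝 sr)) :
    IsAdmissibleShock f a A κ sl c sr c σ := by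
  obtain ⟨S, hS, hS', hb, ht⟩ := hS
  refine ⟨fun h => hne (Prod.ext_iff.1 h).1, ⟨by linarith, by rw [hσ]; ring⟩, S, fun _ => c, hb,
    tendsto_const_nhds, ht, tendsto_const_nhds, fun ε hε => ?_⟩
  refine isDissipativeSolution_of_ode hf ha hA hκ (k := f sl c - σ * sl)
    (m := σ * a c - (f sl c - σ * sl) * c) hS (fun _ => hc) hS' (fun t => ?_) hε
  simpa using hasDerivAt_const t c

theorem isAdmissibleShock_up (hf : FlowAssumptions f a cstar)
    (ha : AdsorptionAssumptions a) (hA : CapillaryAssumptions A) {κ c sl sr σ : ℝ} (hκ : 0 < κ)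
    (hc : c ∈ Icc (0 : ℝ) 1) (hl : 0 ≤ sl) (hlt : sl < sr) (hr : sr ≤ 1)
    (hσ : f sr c = f sl c + σ * (sr - sl))
    (habove : ∀ s ∈ Ioo sl sr, f sl c + σ * (s - sl) < f s c) :
    IsAdmissibleShock f a A κ sl c sr c σ := by
  obtain ⟨K, hK⟩ := exists_lipschitz_slice hf hA hc hl hr σ (f sl c - σ * sl)
  obtain ⟨S, -, hm, hd, hb, ht⟩ := exists_heteroclinic (x₀ := (sl + sr) / 2) hK (by simp)
    (by rw [hσ]; ring) (fun s hs => div_pos (by linarith [habove s hs])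
      (hA.pos ⟨by linarith [hs.1], by linarith [hs.2]⟩ hc)) ⟨by linarith, by linarith⟩
  exact isAdmissibleShock_of_heteroclinic hf ha hA hκ hc hlt.ne hσ ⟨S, fun t =>
    ⟨by linarith [(hm t).1], by linarith [(hm t).2]⟩, hd, hb, ht⟩

theorem isAdmissibleShock_down (hf : FlowAssumptions f a cstar)
    (ha : AdsorptionAssumptions a) (hA : CapillaryAssumptions A) {κ c sl sr σ : ℝ} (hκ : 0 < κ)
    (hc : c ∈ Icc (0 : ℝ) 1) (hr : 0 ≤ sr) (hlt : sr < sl) (hl : sl ≤ 1)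
    (hσ : f sr c = f sl c + σ * (sr - sl))
    (hbelow : ∀ s ∈ Ioo sr sl, f s c < f sl c + σ * (s - sl)) :
    IsAdmissibleShock f a A κ sl c sr c σ := by
  obtain ⟨K, hK⟩ := exists_lipschitz_slice hf hA hc hr hl σ (f sl c - σ * sl)
  obtain ⟨S, -, hm, hd, hb, ht⟩ := exists_heteroclinic_anti (x₀ := (sl + sr) / 2) hK
    (by rw [hσ]; ring) (by simp) (fun s hs => div_neg_of_neg_of_pos (by linarith [hbelow s hs])
      (hA.pos ⟨by linarith [hs.1], by linarith [hs.2]⟩ hc)) ⟨by linarith, by linarith⟩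
  exact isAdmissibleShock_of_heteroclinic hf ha hA hκ hc hlt.ne' hσ ⟨S, fun t =>
    ⟨by linarith [(hm t).1], by linarith [(hm t).2]⟩, hd, hb, ht⟩

/-- The `s`-wave group from a smaller to a larger saturation follows the lower convex envelope of
`f(·, c)`. Its first and last speeds are slopes of the graph or of a chord. -/
theorem exists_sWaveGroup_up (hf : FlowAssumptions f a cstar)
    (ha : AdsorptionAssumptions a) (hA : CapillaryAssumptions A) {κ c sl sr : ℝ} (hκ : 0 < κ)
    (hc : c ∈ Icc (0 : ℝ) 1) (hl : 0 ≤ sl) (hlt : sl < sr) (hr : sr ≤ 1) :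
    ∃ σ₁ σ₂, SWaveGroup f a A κ c sl sr σ₁ σ₂ ∧
      (σ₁ = dS f sl c ∨ f sr c = f sl c + σ₁ * (sr - sl)) ∧
      (σ₂ = dS f sr c ∨ ∃ t ∈ Ico sl sr, f sr c = f t c + σ₂ * (sr - t)) := by
  have hφ := hf.sShaped hc
  have hm : f sr c = f sl c + (f sr c - f sl c) / (sr - sl) * (sr - sl) := by
    rw [div_mul_cancel₀ _ (sub_pos.2 hlt).ne']; ring
  rcases hφ.convex_envelope hl hlt hr hm with h | h | ⟨t, ht, hmono, hchord⟩
  · exact ⟨_, _, .shock sl sr _ (isAdmissibleShock_up hf ha hA hκ hc hl hlt hr hm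
      (hφ.chord_lt hl hr hm h)), Or.inr hm, Or.inr ⟨sl, ⟨le_rfl, hlt⟩, hm⟩⟩
  · exact ⟨_, _, .rarefaction sl sr ⟨⟨hl, by linarith⟩, ⟨by linarith, hr⟩, Or.inl ⟨hlt, h⟩⟩,
      Or.inl rfl, Or.inl rfl⟩
  · have ht0 : 0 ≤ t := hl.trans ht.1.le
    refine ⟨_, _, .comp sl t sr _ _ _ _
      (.rarefaction sl t ⟨⟨hl, by linarith⟩, ⟨ht0, by linarith [ht.2]⟩, Or.inl ⟨ht.1, hmono⟩⟩)
      le_rfl (.shock t sr _ (isAdmissibleShock_up hf ha hA hκ hc ht0 ht.2 hr hchord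
        (hφ.chord_lt ht0 hr hchord le_rfl))), Or.inl rfl, Or.inr ⟨t, ⟨ht.1.le, ht.2⟩, hchord⟩⟩

/-- The `s`-wave group from a larger to a smaller saturation follows the upper concave envelope of
`f(·, c)`. Its first and last speeds are slopes of the graph or of a chord. -/
theorem exists_sWaveGroup_down (hf : FlowAssumptions f a cstar)
    (ha : AdsorptionAssumptions a) (hA : CapillaryAssumptions A) {κ c sl sr : ℝ} (hκ : 0 < κ)
    (hc : c ∈ Icc (0 : ℝ) 1) (hr : 0 ≤ sr) (hlt : sr < sl) (hl : sl ≤ 1) :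
    ∃ σ₁ σ₂, SWaveGroup f a A κ c sl sr σ₁ σ₂ ∧
      (σ₁ = dS f sl c ∨ f sr c = f sl c + σ₁ * (sr - sl)) ∧
      (σ₂ = dS f sr c ∨ ∃ t ∈ Ioc sr sl, f sr c = f t c + σ₂ * (sr - t)) := by
  have hφ := hf.sShaped hc
  have hm : f sr c = f sl c + (f sr c - f sl c) / (sr - sl) * (sr - sl) := by
    rw [div_mul_cancel₀ _ (sub_neg.2 hlt).ne]; ring
  rcases hφ.concave_envelope hr hlt hl hm with h | h | ⟨t, ht, hanti, hchord⟩
  · exact ⟨_, _, .shock sl sr _ (isAdmissibleShock_down hf ha hA hκ hc hr hlt hl hm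
      (hφ.lt_chord hr hl hm h)), Or.inr hm, Or.inr ⟨sl, ⟨hlt, le_rfl⟩, hm⟩⟩
  · exact ⟨_, _, .rarefaction sl sr ⟨⟨by linarith, hl⟩, ⟨hr, by linarith⟩, Or.inr ⟨hlt, h⟩⟩,
      Or.inl rfl, Or.inl rfl⟩
  · have ht1 : t ≤ 1 := ht.2.le.trans hl
    refine ⟨_, _, .comp sl t sr _ _ _ _
      (.rarefaction sl t ⟨⟨by linarith, hl⟩, ⟨by linarith [ht.1], ht1⟩, Or.inr ⟨ht.2, hanti⟩⟩)
      le_rfl (.shock t sr _ (isAdmissibleShock_down hf ha hA hκ hc hr ht.1 ht1 hchord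
        (hφ.lt_chord hr ht1 hchord le_rfl))), Or.inl rfl, Or.inr ⟨t, ⟨ht.1, ht.2.le⟩, hchord⟩⟩

theorem existsUnique_isCriticalShockValue (hf : FlowAssumptions f a cstar) {c h v s : ℝ}
    (hc : c ∈ Icc (0 : ℝ) 1) (hv : 0 < v) (hh : 0 < h) (hs : s ∈ Icc (0 : ℝ) 1)
    (h0 : f s c = v * (s + h)) : ∃! K, IsCriticalShockValue f h v s c K := by
  have hφ := hf.sShaped hc
  have hiff : ∀ K ∈ Icc (0 : ℝ) 1, f K c / (K + h) = v ↔ f K c = v * (K + h) := fun K hK =>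
    div_eq_iff (by linarith [hK.1])
  have no3 : ∀ x ∈ Icc (0 : ℝ) 1, ∀ y, ∀ z ∈ Icc (0 : ℝ) 1, f x c = v * (x + h) →
      f y c = v * (y + h) → f z c = v * (z + h) → x < y → y < z → False :=
    fun x hx y z hz h1 h2 h3 hxy hyz =>
      (hφ.line_lt_between hv hh hx.1 hxy hyz hz.2 h1.ge h3.ge).ne h2.symm
  by_cases hex : ∃ K ∈ Icc (0 : ℝ) 1, f K c = v * (K + h) ∧ K ≠ s
  · obtain ⟨K, hK, hK0, hKs⟩ := hex
    refine ⟨K, ⟨hK, (hiff K hK).2 hK0, Or.inl hKs⟩, ?_⟩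
    rintro K' ⟨hK', hK'0, hor⟩
    rw [hiff K' hK'] at hK'0
    have hK's : K' ≠ s := hor.elim id fun hall => absurd (hall K hK ((hiff K hK).2 hK0)) hKs
    by_contra hne
    rcases lt_or_gt_of_ne hKs with h1 | h1 <;> rcases lt_or_gt_of_ne hK's with h2 | h2 <;>
      rcases lt_or_gt_of_ne hne with h3 | h3
    · exact no3 K' hK' K s hs hK'0 hK0 h0 h3 h1
    · exact no3 K hK K' s hs hK0 hK'0 h0 h3 h2
    · linarith
    · exact no3 K hK s K' hK' hK0 h0 hK'0 h1 h2
    · exact no3 K' hK' s K hK hK'0 h0 hK0 h2 h1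
    · linarith
    · exact no3 s hs K' K hK h0 hK'0 hK0 h2 h3
    · exact no3 s hs K K' hK' h0 hK0 hK'0 h1 h3
  · push Not at hex
    refine ⟨s, ⟨hs, (hiff s hs).2 h0, Or.inr fun K' hK' e => hex K' hK' ((hiff K' hK').1 e)⟩, ?_⟩
    rintro K' ⟨hK', hK'0, -⟩
    exact hex K' hK' ((hiff K' hK').1 hK'0)

/-- If `sm` and `sp` are the last and the first intersection of the graphs of `f(·, cL)` and
`f(·, cR)` with the line `v (s + h)`, the `s`-waves left and right of the `c`-shock are compatible
with it by speed. -/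
theorem compatibleBySpeed (hf : FlowAssumptions f a cstar) (ha : AdsorptionAssumptions a)
    (hA : CapillaryAssumptions A) {κ cL cR h v sm sp Km Kp sL sR : ℝ} (hκ : 0 < κ)
    (hcL : cL ∈ Icc (0 : ℝ) 1) (hcR : cR ∈ Icc (0 : ℝ) 1) (hv : 0 < v) (hh : 0 < h)
    (hsm : sm ∈ Icc (0 : ℝ) 1) (hsp : sp ∈ Icc (0 : ℝ) 1)
    (hsm0 : f sm cL = v * (sm + h)) (hsp0 : f sp cR = v * (sp + h))
    (hlast : ∀ z ∈ Ioc sm 1, f z cL < v * (z + h))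
    (hfirst : ∀ z ∈ Ico 0 sp, f z cR < v * (z + h))
    (hdm : dS f sm cL ≤ v) (hdp : v ≤ dS f sp cR)
    (hKm : IsCriticalShockValue f h v sm cL Km) (hKp : IsCriticalShockValue f h v sp cR Kp)
    (hsL : sL ∈ Icc Km 1) (hsR : sR ∈ Icc 0 Kp) :
    CompatibleBySpeed f a A κ cL cR sL sm sp sR v := by
  have hKm0 : f Km cL = v * (Km + h) := (div_eq_iff (by linarith [hKm.1.1])).1 hKm.2.1
  have hKp0 : f Kp cR = v * (Kp + h) := (div_eq_iff (by linarith [hKp.1.1])).1 hKp.2.1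
  constructor
  · rcases lt_trichotomy sL sm with hlt | heq | hgt
    · obtain ⟨σ₁, σ₂, hg, -, h2⟩ := exists_sWaveGroup_up hf ha hA hκ hcL (hKm.1.1.trans hsL.1) hlt
        hsm.2
      refine Or.inr ⟨σ₁, σ₂, hg, ?_⟩
      rcases h2 with h2 | ⟨t, ht, h2⟩
      · exact h2 ▸ hdm
      · have : v * (t + h) ≤ f t cL := by
          rcases (hsL.1.trans ht.1).eq_or_lt with rfl | hlt'
          · exact hKm0.ge
          · exact ((hf.sShaped hcL).line_lt_between hv hh hKm.1.1 hlt' ht.2 hsm.2 hKm0.ge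
              hsm0.ge).le
        refine le_of_mul_le_mul_right ?_ (sub_pos.2 ht.2)
        linarith
    · exact Or.inl heq
    · obtain ⟨σ₁, σ₂, hg, -, h2⟩ := exists_sWaveGroup_down hf ha hA hκ hcL hsm.1 hgt hsL.2
      refine Or.inr ⟨σ₁, σ₂, hg, ?_⟩
      rcases h2 with h2 | ⟨t, ht, h2⟩
      · exact h2 ▸ hdm
      · have := hlast t ⟨ht.1, ht.2.trans hsL.2⟩
        refine le_of_mul_le_mul_right ?_ (sub_pos.2 ht.1)
        linarith
  · rcases lt_trichotomy sp sR with hlt | heq | hgt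
    · obtain ⟨σ₁, σ₂, hg, h1, -⟩ := exists_sWaveGroup_up hf ha hA hκ hcR hsp.1 hlt
        (hsR.2.trans hKp.1.2)
      refine Or.inr ⟨σ₁, σ₂, hg, ?_⟩
      rcases h1 with h1 | h1
      · exact h1 ▸ hdp
      · have : v * (sR + h) ≤ f sR cR := by
          rcases hsR.2.eq_or_lt with rfl | hlt'
          · exact hKp0.ge
          · exact ((hf.sShaped hcR).line_lt_between hv hh hsp.1 hlt hlt' hKp.1.2 hsp0.ge
              hKp0.ge).le
        refine le_of_mul_le_mul_right ?_ (sub_pos.2 hlt)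
        linarith
    · exact Or.inl heq
    · obtain ⟨σ₁, σ₂, hg, h1, -⟩ := exists_sWaveGroup_down hf ha hA hκ hcR hsR.1 hgt hsp.2
      refine Or.inr ⟨σ₁, σ₂, hg, ?_⟩
      rcases h1 with h1 | h1
      · exact h1 ▸ hdp
      · have := hfirst sR ⟨hsR.1, hgt⟩
        refine le_of_mul_le_mul_right ?_ (sub_pos.2 hgt)
        linarith

end SWaves

/-! ### Reduction of the `c`-shock to a scalar equation -/

/-- The concentration in a `c`-shock, in the time `v ξ / κ`, in which its equation depends neither
on `v` nor on `κ`. -/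
structure ConcentrationProfile (a : ℝ → ℝ) (cL cR : ℝ) (C : ℝ → ℝ) : Prop where
  mem : ∀ t, C t ∈ Ioo cR cL
  hasDeriv : ∀ t, HasDerivAt C (-chordGap a cL cR (C t)) t
  atBot : Tendsto C atBot (𝓝 cL)
  atTop : Tendsto C atTop (𝓝 cR)

/-- The right-hand side of the equation for the saturation along a concentration profile. -/
noncomputable def reducedField (f : ℝ → ℝ → ℝ) (A : ℝ → ℝ → ℝ) (h κ v s c : ℝ) : ℝ :=
  κ * (f s c - v * (s + h)) / (v * A s c)

/-- `S` solves the reduced equation along the concentration profile `C`, with values in `[0,1]`. -/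
structure IsReducedWave (f : ℝ → ℝ → ℝ) (A : ℝ → ℝ → ℝ) (h κ v : ℝ) (C S : ℝ → ℝ) : Prop where
  mem : ∀ t, S t ∈ Icc (0 : ℝ) 1
  hasDeriv : ∀ t, HasDerivAt S (reducedField f A h κ v (S t) (C t)) t

section Reduction

variable {f : ℝ → ℝ → ℝ} {a : ℝ → ℝ} {A : ℝ → ℝ → ℝ} {cstar cL cR : ℝ}

theorem AdsorptionAssumptions.exists_lipschitz_chordGap (ha : AdsorptionAssumptions a) :
    ∃ K : ℝ≥0, LipschitzOnWith K (fun c => -chordGap a cL cR c) (Icc 0 1) := by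
  have : ContDiffOn ℝ 2 (fun c => -chordGap a cL cR c) (Icc 0 1) := by
    unfold chordGap
    exact ((ha.smooth.sub contDiffOn_const).sub (by fun_prop)).neg
  exact this.exists_lipschitzOnWith (by norm_num) (convex_Icc _ _) isCompact_Icc

theorem exists_concentrationProfile (ha : AdsorptionAssumptions a) (hL : cL ≤ 1) (hR : 0 ≤ cR)
    {c₀ : ℝ} (hc₀ : c₀ ∈ Ioo cR cL) : ∃ C, ConcentrationProfile a cL cR C ∧ C 0 = c₀ := by
  have hlt := hc₀.1.trans hc₀.2
  obtain ⟨K, hK⟩ := ha.exists_lipschitz_chordGap (cL := cL) (cR := cR)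
  obtain ⟨C, h0, hm, hd, hb, ht⟩ := exists_heteroclinic_anti (hK.mono (Icc_subset_Icc hR hL))
    (by rw [chordGap_right hlt, neg_zero]) (by rw [chordGap_left, neg_zero])
    (fun c hc => neg_neg_of_pos (ha.chordGap_pos hL hR hlt hc)) hc₀
  exact ⟨C, ⟨hm, hd, hb, ht⟩, h0⟩

/-- The Rankine–Hugoniot conditions of a `c`-shock say that both states lie on the line
`v (s + h)`. -/
theorem rankineHugoniot_iff (hlt : cR < cL) {sm sp v : ℝ} :
    RankineHugoniot f a sm cL sp cR v ↔ f sm cL = v * (sm + chordSlope a cL cR) ∧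
      f sp cR = v * (sp + chordSlope a cL cR) := by
  have hh := chordSlope_mul (a := a) hlt
  constructor
  · rintro ⟨h1, h2⟩
    have h3 : f sm cL - v * sm = v * chordSlope a cL cR := by
      refine mul_right_cancel₀ (sub_pos.2 hlt).ne' ?_
      linear_combination h2 - cR * h1 - v * hh
    exact ⟨by linarith, by linarith⟩
  · rintro ⟨h1, h2⟩
    exact ⟨by rw [h1, h2]; ring, by rw [h1, h2]; linear_combination v * hh⟩

theorem isAdmissibleShock_of_reducedWave (hf : FlowAssumptions f a cstar)
    (ha : AdsorptionAssumptions a) (hA : CapillaryAssumptions A) {κ v sm sp : ℝ} (hκ : 0 < κ)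
    (hv : 0 < v) (hL : cL ≤ 1) (hR : 0 ≤ cR) (hlt : cR < cL) {C S : ℝ → ℝ}
    (hC : ConcentrationProfile a cL cR C)
    (hS : IsReducedWave f A (chordSlope a cL cR) κ v C S)
    (hb : Tendsto S atBot (𝓝 sm)) (ht : Tendsto S atTop (𝓝 sp))
    (hsm : f sm cL = v * (sm + chordSlope a cL cR))
    (hsp : f sp cR = v * (sp + chordSlope a cL cR)) :
    IsAdmissibleShock f a A κ sm cL sp cR v := by
  have hvκ : 0 < v / κ := div_pos hv hκ
  have hCm : ∀ t, C t ∈ Icc (0 : ℝ) 1 := fun t =>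
    ⟨by linarith [(hC.mem t).1], by linarith [(hC.mem t).2]⟩
  have hlin : ∀ t : ℝ, HasDerivAt (fun ξ => v / κ * ξ) (v / κ) t := fun t => by
    simpa using (hasDerivAt_id t).const_mul (v / κ)
  refine ⟨fun e => hlt.ne' (Prod.ext_iff.1 e).2, (rankineHugoniot_iff hlt).2 ⟨hsm, hsp⟩,
    fun ξ => S (v / κ * ξ), fun ξ => C (v / κ * ξ),
    hb.comp (tendsto_id.const_mul_atBot hvκ), hC.atBot.comp (tendsto_id.const_mul_atBot hvκ),
    ht.comp (tendsto_id.const_mul_atTop hvκ), hC.atTop.comp (tendsto_id.const_mul_atTop hvκ),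
    fun ε hε => ?_⟩
  refine isDissipativeSolution_of_ode hf ha hA hκ (S := fun ξ => S (v / κ * ξ))
    (C := fun ξ => C (v / κ * ξ)) (k := v * chordSlope a cL cR)
    (m := v * a cL - v * chordSlope a cL cR * cL) (fun _ => hS.mem _) (fun _ => hCm _)
    (fun t => ?_) (fun t => ?_) hε
  · refine ((hS.hasDeriv _).comp t (hlin t)).congr_deriv ?_
    have := (hA.pos (hS.mem (v / κ * t)) (hCm (v / κ * t))).ne'
    unfold reducedField
    field_simp
    ring
  · refine ((hC.hasDeriv _).comp t (hlin t)).congr_deriv ?_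
    unfold chordGap
    field_simp
    ring

/-- Conversely, the travelling wave of an admissible `c`-shock is, up to a shift and a change of the
unit of time, a solution of the reduced equation along any given concentration profile. -/
theorem exists_reducedWave_of_isAdmissibleShock (hf : FlowAssumptions f a cstar)
    (ha : AdsorptionAssumptions a) (hA : CapillaryAssumptions A) {κ v sm sp : ℝ} (hκ : 0 < κ)
    (hv : 0 < v) (hcL : cL ∈ Icc (0 : ℝ) 1) (hcR : cR ∈ Icc (0 : ℝ) 1) (hlt : cR < cL)
    {C : ℝ → ℝ} (hC : ConcentrationProfile a cL cR C) (hsm : sm ∈ Icc (0 : ℝ) 1)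
    (hsh : IsAdmissibleShock f a A κ sm cL sp cR v) :
    ∃ S, IsReducedWave f A (chordSlope a cL cR) κ v C S ∧ Tendsto S atBot (𝓝 sm) ∧
      Tendsto S atTop (𝓝 sp) := by
  obtain ⟨-, hRH, S, D, hSb, hDb, hSt, hDt, hsol⟩ := hsh
  obtain ⟨hm0, -⟩ := (rankineHugoniot_iff hlt).1 hRH
  obtain ⟨hS, hD, hS', hD'⟩ := ode_of_isDissipativeSolution hf ha hA hκ hsm hcL hSb hDb
    (hsol 1 one_pos)
  have hvκ : 0 < κ / v := div_pos hκ hv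
  have hDc : Continuous D := continuous_iff_continuousAt.2 fun t => (hD' t).continuousAt
  -- the shift that matches the concentrations
  obtain ⟨ξ₀, hξ₀⟩ : ∃ ξ₀, D ξ₀ = C 0 := by
    obtain ⟨t₁, h1⟩ := (hDb.eventually (lt_mem_nhds (hC.mem 0).2)).exists
    obtain ⟨t₂, h2⟩ := (hDt.eventually (gt_mem_nhds (hC.mem 0).1)).exists
    exact mem_range_of_exists_le_of_exists_ge hDc ⟨t₂, h2.le⟩ ⟨t₁, h1.le⟩
  have hlin : ∀ t : ℝ, HasDerivAt (fun τ => κ / v * τ + ξ₀) (κ / v) t := fun t => by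
    simpa using ((hasDerivAt_id t).const_mul (κ / v)).add_const ξ₀
  have hDC : (fun τ => D (κ / v * τ + ξ₀)) = C := by
    obtain ⟨K, hK⟩ := ha.exists_lipschitz_chordGap (cL := cL) (cR := cR)
    refine ODE_solution_unique_univ (v := fun _ c => -chordGap a cL cR c)
      (s := fun _ => Icc 0 1) (K := K) (t₀ := 0) (fun _ => hK) (fun t => ⟨?_, hD _⟩)
      (fun t => ⟨hC.hasDeriv t, ⟨by linarith [(hC.mem t).1, hcR.1],
        by linarith [(hC.mem t).2, hcL.2]⟩⟩) (by simpa using hξ₀)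
    refine ((hD' _).comp t (hlin t)).congr_deriv ?_
    rw [hm0]
    unfold chordGap
    field_simp
    ring
  have hbot : Tendsto (fun τ => κ / v * τ + ξ₀) atBot atBot :=
    tendsto_atBot_add_const_right _ _ (tendsto_id.const_mul_atBot hvκ)
  have htop : Tendsto (fun τ => κ / v * τ + ξ₀) atTop atTop :=
    tendsto_atTop_add_const_right _ _ (tendsto_id.const_mul_atTop hvκ)
  refine ⟨fun τ => S (κ / v * τ + ξ₀), ⟨fun _ => hS _, fun t => ?_⟩, hSb.comp hbot, hSt.comp htop⟩
  refine ((hS' _).comp t (hlin t)).congr_deriv ?_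
  have hDt : D (κ / v * t + ξ₀) = C t := congrFun hDC t
  have := (hA.pos (hS (κ / v * t + ξ₀)) (hD (κ / v * t + ξ₀))).ne'
  rw [hm0]
  rw [hDt] at this ⊢
  unfold reducedField
  field_simp
  ring

theorem reducedField_pos (hA : CapillaryAssumptions A) {h κ v s c : ℝ} (hκ : 0 < κ) (hv : 0 < v)
    (hs : s ∈ Icc (0 : ℝ) 1) (hc : c ∈ Icc (0 : ℝ) 1) (hlt : v * (s + h) < f s c) :
    0 < reducedField f A h κ v s c :=
  div_pos (mul_pos hκ (sub_pos.2 hlt)) (mul_pos hv (hA.pos hs hc))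

theorem reducedField_neg (hA : CapillaryAssumptions A) {h κ v s c : ℝ} (hκ : 0 < κ) (hv : 0 < v)
    (hs : s ∈ Icc (0 : ℝ) 1) (hc : c ∈ Icc (0 : ℝ) 1) (hlt : f s c < v * (s + h)) :
    reducedField f A h κ v s c < 0 :=
  div_neg_of_neg_of_pos (mul_neg_of_pos_of_neg hκ (sub_neg.2 hlt)) (mul_pos hv (hA.pos hs hc))

theorem reducedField_eq_zero_iff (hA : CapillaryAssumptions A) {h κ v s c : ℝ} (hκ : 0 < κ)
    (hv : 0 < v) (hs : s ∈ Icc (0 : ℝ) 1) (hc : c ∈ Icc (0 : ℝ) 1) :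
    reducedField f A h κ v s c = 0 ↔ f s c = v * (s + h) := by
  have := mul_pos hv (hA.pos hs hc)
  rw [reducedField, div_eq_zero_iff, or_iff_left this.ne', mul_eq_zero, or_iff_right hκ.ne',
    sub_eq_zero]

theorem exists_lipschitz_reducedField (hf : FlowAssumptions f a cstar)
    (hA : CapillaryAssumptions A) (h κ v : ℝ) : ∃ K : ℝ≥0, 0 < K ∧ LipschitzOnWith K
      (fun p : ℝ × ℝ => reducedField f A h κ v p.1 p.2) (Icc 0 1 ×ˢ Icc 0 1) := by
  obtain ⟨K, hK⟩ := exists_lipschitz_field hf hA v (v * h)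
  refine ⟨‖κ / v‖₊ * K + 1, by positivity, LipschitzOnWith.of_dist_le_mul fun p hp q hq => ?_⟩
  have h1 := hK.dist_le_mul p hp q hq
  have e : ∀ p : ℝ × ℝ, reducedField f A h κ v p.1 p.2
      = κ / v * ((f p.1 p.2 - v * p.1 - v * h) / A p.1 p.2) := fun p => by
    rw [reducedField, div_mul_div_comm]; ring
  rw [e, e, Real.dist_eq, ← mul_sub, abs_mul, ← Real.dist_eq, NNReal.coe_add, NNReal.coe_mul,
    coe_nnnorm, Real.norm_eq_abs, add_mul, mul_assoc]
  have := mul_le_mul_of_nonneg_left h1 (abs_nonneg (κ / v))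
  have h3 : (0 : ℝ) ≤ dist p q := dist_nonneg
  simp only [NNReal.coe_one, one_mul]
  linarith

/-- The reduced field along a concentration profile, extended to all saturations by its values at
the end points of `[0,1]`. -/
noncomputable def clampedField (f : ℝ → ℝ → ℝ) (A : ℝ → ℝ → ℝ) (h κ : ℝ) (C : ℝ → ℝ)
    (v t x : ℝ) : ℝ :=
  reducedField f A h κ v (projIcc (0 : ℝ) 1 zero_le_one x) (C t)

variable {h κ : ℝ} {C : ℝ → ℝ}

theorem clampedField_of_mem {v t x : ℝ} (hx : x ∈ Icc (0 : ℝ) 1) :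
    clampedField f A h κ C v t x = reducedField f A h κ v x (C t) := by
  rw [clampedField, projIcc_of_mem zero_le_one hx]

theorem clampedField_regular (hf : FlowAssumptions f a cstar) (hA : CapillaryAssumptions A)
    (hCc : Continuous C) (hC : ∀ t, C t ∈ Icc (0 : ℝ) 1) (v : ℝ) :
    ∃ K M : ℝ≥0, 0 < K ∧ (∀ t, LipschitzWith K (clampedField f A h κ C v t)) ∧
      (∀ x, Continuous fun t => clampedField f A h κ C v t x) ∧
      ∀ t x, |clampedField f A h κ C v t x| ≤ M := by
  obtain ⟨K, hK, hL⟩ := exists_lipschitz_reducedField hf hA h κ v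
  obtain ⟨M, hM⟩ := (isCompact_Icc.prod isCompact_Icc).exists_bound_of_continuousOn hL.continuousOn
  refine ⟨K, M.toNNReal, hK, fun t => LipschitzWith.of_dist_le_mul fun x y => ?_, fun x => ?_,
    fun t x => ?_⟩
  · have h1 := hL.dist_le_mul (projIcc (0 : ℝ) 1 zero_le_one x, C t)
      ⟨(projIcc (0 : ℝ) 1 zero_le_one x).2, hC t⟩ (projIcc (0 : ℝ) 1 zero_le_one y, C t)
      ⟨(projIcc (0 : ℝ) 1 zero_le_one y).2, hC t⟩
    have h2 := (LipschitzWith.projIcc (zero_le_one' ℝ)).dist_le_mul x y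
    rw [NNReal.coe_one, one_mul] at h2
    refine h1.trans (mul_le_mul_of_nonneg_left ?_ K.2)
    rw [Prod.dist_eq, dist_self]
    exact max_le h2 dist_nonneg
  · exact hL.continuousOn.comp_continuous (continuous_const.prodMk hCc) fun t =>
      ⟨(projIcc (0 : ℝ) 1 zero_le_one x).2, hC t⟩
  · exact (hM (_, C t) ⟨(projIcc (0 : ℝ) 1 zero_le_one x).2, hC t⟩).trans (Real.le_coe_toNNReal M)

theorem exists_clampedField_sub_le (hf : FlowAssumptions f a cstar) (hA : CapillaryAssumptions A)
    (hC : ∀ t, C t ∈ Icc (0 : ℝ) 1) : ∃ B : ℝ, ∀ v v', 0 < v → 0 < v' → ∀ t x,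
      |clampedField f A h κ C v' t x - clampedField f A h κ C v t x| ≤ B * |v'⁻¹ - v⁻¹| := by
  obtain ⟨M, hM⟩ := (isCompact_Icc.prod isCompact_Icc).exists_bound_of_continuousOn
    (hf.smooth.continuousOn.div hA.continuousOn fun p hp => (hA.pos hp.1 hp.2).ne')
  refine ⟨|κ| * M, fun v v' hv hv' t x => ?_⟩
  have hx := (projIcc (0 : ℝ) 1 zero_le_one x).2
  have hAp := (hA.pos hx (hC t)).ne'
  have h1 := hM (_, C t) ⟨hx, hC t⟩
  have e : clampedField f A h κ C v' t x - clampedField f A h κ C v t x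
      = κ * (f (projIcc (0 : ℝ) 1 zero_le_one x) (C t) / A (projIcc (0 : ℝ) 1 zero_le_one x) (C t))
        * (v'⁻¹ - v⁻¹) := by
    unfold clampedField reducedField
    field_simp
    ring
  rw [e, abs_mul, abs_mul]
  gcongr
  exact h1

/-- Solutions depend continuously on the shock velocity and on the initial value. -/
theorem tendsto_solution (hf : FlowAssumptions f a cstar) (hA : CapillaryAssumptions A)
    (hCc : Continuous C) (hC : ∀ t, C t ∈ Icc (0 : ℝ) 1) {ι : Type*} {l : Filter ι} {w : ι → ℝ}
    {Y : ι → ℝ → ℝ} {v t₀ : ℝ} {X : ℝ → ℝ} (hv : 0 < v)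
    (hX : ∀ t, HasDerivAt X (clampedField f A h κ C v t (X t)) t)
    (hY : ∀ᶠ i in l, 0 < w i ∧ ∀ t, HasDerivAt (Y i) (clampedField f A h κ C (w i) t (Y i t)) t)
    (hw : Tendsto w l (𝓝 v)) (h0 : Tendsto (fun i => Y i t₀) l (𝓝 (X t₀))) (t : ℝ) :
    Tendsto (fun i => Y i t) l (𝓝 (X t)) := by
  obtain ⟨K, M, hK, hL, -, -⟩ := clampedField_regular (h := h) (κ := κ) hf hA hCc hC v
  obtain ⟨B, hB⟩ := exists_clampedField_sub_le (h := h) (κ := κ) hf hA hC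
  have hlim : Tendsto (fun i => |X t₀ - Y i t₀| * Real.exp (K * |t - t₀|)
      + B * |(w i)⁻¹ - v⁻¹| / K * (Real.exp (K * |t - t₀|) - 1)) l (𝓝 0) := by
    have h1 : Tendsto (fun i => |X t₀ - Y i t₀|) l (𝓝 0) := by
      simpa using (h0.const_sub (X t₀)).abs
    have h2 : Tendsto (fun i => |(w i)⁻¹ - v⁻¹|) l (𝓝 0) := by
      simpa using ((hw.inv₀ hv.ne').sub_const v⁻¹).abs
    simpa using (h1.mul_const (Real.exp (K * |t - t₀|))).add
      (((h2.const_mul B).div_const (K : ℝ)).mul_const (Real.exp (K * |t - t₀|) - 1))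
  rw [tendsto_iff_dist_tendsto_zero]
  refine squeeze_zero' (Eventually.of_forall fun _ => dist_nonneg) ?_ hlim
  filter_upwards [hY] with i hi
  rw [dist_comm, Real.dist_eq]
  exact abs_sub_le_of_solutions hK hL hX hi.2 (fun t x => hB v (w i) hv hi.1 t x) le_rfl t

/-- A solution that starts below `1` and ends above `0` stays in `[0,1]`. -/
theorem mem_unit_of_endpoints (hf : FlowAssumptions f a cstar) (hA : CapillaryAssumptions A)
    (hC : ∀ t, C t ∈ Icc (0 : ℝ) 1) (hκ : 0 < κ) (hh : 0 < h) {v : ℝ} (hv : 0 < v)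
    (hv1 : 1 < v * (1 + h)) {X : ℝ → ℝ}
    (hX : ∀ t, HasDerivAt X (clampedField f A h κ C v t (X t)) t) {T₁ T₂ : ℝ} (h1 : X T₁ ≤ 1)
    (h2 : 0 ≤ X T₂) : ∀ t ∈ Icc T₁ T₂, X t ∈ Icc (0 : ℝ) 1 := by
  intro t ht
  constructor
  · by_contra! hneg
    have := le_of_deriv_neg_at_level hX (l := X t) le_rfl (b := T₂) (fun s _ _ hs => by
      rw [clampedField, projIcc_of_le_left zero_le_one (hs.le.trans hneg.le)]
      refine reducedField_neg hA hκ hv (by simp) (hC s) ?_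
      rw [hf.at_zero _ (hC s), zero_add]
      exact mul_pos hv hh) T₂ ⟨ht.2, le_rfl⟩
    linarith
  · refine le_of_deriv_neg_at_level hX h1 (b := T₂) (fun s _ _ hs => ?_) t ht
    rw [hs, clampedField_of_mem (by simp)]
    refine reducedField_neg hA hκ hv (by simp) (hC s) ?_
    rwa [hf.at_one _ (hC s)]

end Reduction

/-! ### Existence by shooting -/

section Shooting

theorem SShaped.lt_line_after {φ φ' : ℝ → ℝ} (hφ : SShaped φ φ') {v h m s : ℝ} (hv : 0 < v)
    (hh : 0 < h) (hm0 : 0 ≤ m) (hm : v * (m + h) < φ m) (hms : m ≤ s) (h0 : φ s = v * (s + h)) :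
    ∀ z ∈ Ioc s 1, φ z < v * (z + h) := by
  intro z hz
  by_contra! hle
  have hlt : m < s := lt_of_le_of_ne hms (by rintro rfl; linarith)
  exact (hφ.line_lt_between hv hh hm0 hlt hz.1 hz.2 hm.le hle).ne h0.symm

theorem SShaped.lt_line_before {φ φ' : ℝ → ℝ} (hφ : SShaped φ φ') {v h m s : ℝ} (hv : 0 < v)
    (hh : 0 < h) (hm1 : m ≤ 1) (hm : v * (m + h) < φ m) (hsm : s ≤ m) (h0 : φ s = v * (s + h)) :
    ∀ z ∈ Ico 0 s, φ z < v * (z + h) := by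
  intro z hz
  by_contra! hle
  have hlt : s < m := lt_of_le_of_ne hsm (by rintro rfl; linarith)
  exact (hφ.line_lt_between hv hh hz.1 hz.2 hlt hm1 hle hm.le).ne h0.symm

/-- A line `v (s + h)` that is nowhere below the graph touches it only once. -/
theorem SShaped.lt_line_of_tangent {φ φ' : ℝ → ℝ} (hφ : SShaped φ φ') {v h s : ℝ} (hv : 0 < v)
    (hh : 0 < h) (hmax : ∀ z ∈ Icc (0 : ℝ) 1, φ z ≤ v * (z + h)) (hs : s ∈ Icc (0 : ℝ) 1)
    (h0 : φ s = v * (s + h)) : ∀ z ∈ Icc (0 : ℝ) 1, z ≠ s → φ z < v * (z + h) := by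
  intro z hz hne
  by_contra! hle
  rcases lt_or_gt_of_ne hne with hlt | hlt
  · have := hφ.line_lt_between hv hh hz.1 (y := (z + s) / 2) (by linarith) (by linarith) hs.2 hle
      h0.ge
    linarith [hmax ((z + s) / 2) ⟨by linarith [hz.1, hs.1], by linarith [hz.2, hs.2]⟩]
  · have := hφ.line_lt_between hv hh hs.1 (y := (z + s) / 2) (by linarith) (by linarith) hz.2 h0.ge
      hle
    linarith [hmax ((z + s) / 2) ⟨by linarith [hz.1, hs.1], by linarith [hz.2, hs.2]⟩]

variable {f : ℝ → ℝ → ℝ} {a : ℝ → ℝ} {A : ℝ → ℝ → ℝ} {cstar cL cR h κ : ℝ} {C : ℝ → ℝ}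

/-- Shooting on a finite interval. A solution that starts at `1` ends above `0` for the smallest
velocity. If it ends below `0` for the largest one, an intermediate velocity makes it end at `0`;
otherwise the largest velocity is kept, and at the side at which it is critical the boundary
condition is dropped. -/
theorem exists_shooting (hf : FlowAssumptions f a cstar) (hA : CapillaryAssumptions A)
    (hCc : Continuous C) (hC : ∀ t, C t ∈ Icc (0 : ℝ) 1) (hκ : 0 < κ) (hh : 0 < h)
    {vmin vmax VL VR s₀ T : ℝ} (hvmin : 0 < vmin) (hlt : vmin < vmax) (h1 : 1 < vmin * (1 + h))
    (hs₀ : s₀ ∈ Ioo (0 : ℝ) 1) (hbar : ∀ c ∈ Icc (0 : ℝ) 1, vmin * (s₀ + h) < f s₀ c)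
    (hV : vmax = VL ∨ vmax = VR) (hT : 0 < T) :
    ∃ v ∈ Icc vmin vmax, ∃ X : ℝ → ℝ,
      (∀ t, HasDerivAt X (clampedField f A h κ C v t (X t)) t) ∧
      (∀ t ∈ Icc (-T) T, X t ∈ Icc (0 : ℝ) 1) ∧ (X (-T) = 1 ∨ v = VL) ∧ (X T = 0 ∨ v = VR) := by
  have hTT : T ∈ Icc (-T) T := ⟨by linarith, le_rfl⟩
  have ex : ∀ v x, ∃ X : ℝ → ℝ, X (-T) = x ∧
      ∀ t, HasDerivAt X (clampedField f A h κ C v t (X t)) t := fun v x => by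
    obtain ⟨K, M, -, hL, hc, hM⟩ := clampedField_regular (h := h) (κ := κ) hf hA hCc hC v
    exact exists_global_solution hL hc hM (-T) x
  choose X hX0 hX using ex
  have hvpos : ∀ v ∈ Icc vmin vmax, 0 < v := fun v hv => hvmin.trans_le hv.1
  have hv1 : ∀ v ∈ Icc vmin vmax, 1 < v * (1 + h) := fun v hv =>
    h1.trans_le (mul_le_mul_of_nonneg_right hv.1 (by linarith))
  have hmax : vmax ∈ Icc vmin vmax := ⟨hlt.le, le_rfl⟩
  have cont_v : ContinuousOn (fun v => X v 1 T) (Icc vmin vmax) := fun v hv =>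
    tendsto_solution (h := h) (κ := κ) hf hA hCc hC (w := id) (Y := fun v => X v 1) (t₀ := -T)
      (hvpos v hv) (hX v 1) (eventually_of_mem self_mem_nhdsWithin fun w hw =>
        ⟨hvpos w hw, hX w 1⟩) (tendsto_id.mono_left inf_le_left)
      (by simp only [hX0]; exact tendsto_const_nhds) T
  have cont_x : Continuous fun x => X vmax x T := continuous_iff_continuousAt.2 fun x =>
    tendsto_solution (h := h) (κ := κ) hf hA hCc hC (w := fun _ => vmax) (Y := fun x => X vmax x)
      (t₀ := -T) (hvpos _ hmax) (hX vmax x) (Eventually.of_forall fun y => ⟨hvpos _ hmax, hX _ y⟩)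
      tendsto_const_nhds (by simp only [hX0]; exact tendsto_id) T
  have hstart : 0 ≤ X vmin 1 T := by
    refine hs₀.1.le.trans (ge_of_deriv_pos_at_level (hX vmin 1) (l := s₀) (T := -T) (b := T)
      (by rw [hX0]; exact hs₀.2.le) (fun t _ _ ht => ?_) T hTT)
    rw [ht, clampedField_of_mem (Ioo_subset_Icc_self hs₀)]
    exact reducedField_pos hA hκ hvmin (Ioo_subset_Icc_self hs₀) (hC t) (hbar _ (hC t))
  rcases le_or_gt (X vmax 1 T) 0 with hend | hend
  · obtain ⟨v, hv, h0⟩ := intermediate_value_Icc' hlt.le cont_v ⟨hend, hstart⟩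
    exact ⟨v, hv, X v 1, hX v 1, mem_unit_of_endpoints hf hA hC hκ hh (hvpos v hv) (hv1 v hv)
      (hX v 1) (hX0 v 1).le h0.ge, Or.inl (hX0 v 1), Or.inl h0⟩
  · rcases hV with hV | hV
    · have h0 : X vmax 0 T ≤ 0 := le_of_deriv_neg_at_level (hX vmax 0) (T := -T) (b := T)
        (by rw [hX0]) (fun t _ _ ht => by
          rw [ht, clampedField_of_mem (by simp)]
          refine reducedField_neg hA hκ (hvpos _ hmax) (by simp) (hC t) ?_
          rw [hf.at_zero _ (hC t), zero_add]
          exact mul_pos (hvpos _ hmax) hh) T hTT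
      obtain ⟨x, hx, hx0⟩ := intermediate_value_Icc zero_le_one cont_x.continuousOn ⟨h0, hend.le⟩
      exact ⟨vmax, hmax, X vmax x, hX _ x, mem_unit_of_endpoints hf hA hC hκ hh (hvpos _ hmax)
        (hv1 _ hmax) (hX _ x) ((hX0 _ x).le.trans hx.2) hx0.ge, Or.inr hV, Or.inl hx0⟩
    · exact ⟨vmax, hmax, X vmax 1, hX _ 1, mem_unit_of_endpoints hf hA hC hκ hh (hvpos _ hmax)
        (hv1 _ hmax) (hX _ 1) (hX0 _ 1).le hend.le, Or.inl (hX0 _ 1), Or.inr hV⟩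

theorem finite_zeros_reducedField (hf : FlowAssumptions f a cstar) (hA : CapillaryAssumptions A)
    (hκ : 0 < κ) (hh : 0 < h) {v c : ℝ} (hv : 0 < v) (hc : c ∈ Icc (0 : ℝ) 1) :
    {s ∈ Icc (0 : ℝ) 1 | reducedField f A h κ v s c = 0}.Finite :=
  ((hf.sShaped hc).finite_line hv hh).subset fun _ hs =>
    ⟨hs.1, (reducedField_eq_zero_iff hA hκ hv hs.1 hc).1 hs.2⟩

/-- The limit of the solutions of the shooting problems on growing intervals connects the last
intersection with the line `v (s + h)` at `cL` to the first one at `cR`: where `v` is not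
critical, the boundary condition keeps the solutions above, or below, a level between the two
intersections. -/
theorem exists_connection (hf : FlowAssumptions f a cstar) (hA : CapillaryAssumptions A)
    (hcL : cL ∈ Icc (0 : ℝ) 1) (hcR : cR ∈ Icc (0 : ℝ) 1) (hC : ConcentrationProfile a cL cR C)
    (hκ : 0 < κ) (hh : 0 < h) {vmin vmax VL VR s₀ mL mR : ℝ} (hvmin : 0 < vmin)
    (hlt : vmin < vmax) (h1 : 1 < vmin * (1 + h)) (hs₀ : s₀ ∈ Ioo (0 : ℝ) 1)
    (hbar : ∀ c ∈ Icc (0 : ℝ) 1, vmin * (s₀ + h) < f s₀ c)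
    (hVL : ∀ s ∈ Icc (0 : ℝ) 1, f s cL ≤ VL * (s + h)) (hmL : mL ∈ Ioo (0 : ℝ) 1)
    (hmL0 : f mL cL = VL * (mL + h))
    (hVR : ∀ s ∈ Icc (0 : ℝ) 1, f s cR ≤ VR * (s + h)) (hmR : mR ∈ Ioo (0 : ℝ) 1)
    (hmR0 : f mR cR = VR * (mR + h))
    (hleL : vmax ≤ VL) (hleR : vmax ≤ VR) (hV : vmax = VL ∨ vmax = VR) :
    ∃ v ∈ Icc vmin vmax, ∃ S : ℝ → ℝ, IsReducedWave f A h κ v C S ∧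
      (∃ sm ∈ Icc (0 : ℝ) 1, Tendsto S atBot (𝓝 sm) ∧ f sm cL = v * (sm + h) ∧
        ∀ z ∈ Ioc sm 1, f z cL < v * (z + h)) ∧
      ∃ sp ∈ Icc (0 : ℝ) 1, Tendsto S atTop (𝓝 sp) ∧ f sp cR = v * (sp + h) ∧
        ∀ z ∈ Ico 0 sp, f z cR < v * (z + h) := by
  have hCm : ∀ t, C t ∈ Icc (0 : ℝ) 1 := fun t =>
    ⟨by linarith [(hC.mem t).1, hcR.1], by linarith [(hC.mem t).2, hcL.2]⟩
  have hCc : Continuous C := continuous_iff_continuousAt.2 fun t => (hC.hasDeriv t).continuousAt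
  have shoot := fun n : ℕ => exists_shooting (h := h) (κ := κ) hf hA hCc hCm hκ hh hvmin hlt h1
    hs₀ hbar hV (T := (n : ℝ) + 1) (by positivity)
  choose w hw Y hY hYm hYL hYR using shoot
  have hmem : ∀ n, (w n, Y n 0) ∈ Icc vmin vmax ×ˢ Icc (0 : ℝ) 1 := fun n =>
    ⟨hw n, hYm n 0 ⟨by linarith [n.cast_nonneg (α := ℝ)], by positivity⟩⟩
  obtain ⟨⟨v, x₀⟩, ⟨hv, hx₀⟩, θ, hθ, hlim⟩ :=
    (isCompact_Icc.prod isCompact_Icc).tendsto_subseq hmem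
  simp only at hv hx₀
  have hwlim : Tendsto (fun n => w (θ n)) atTop (𝓝 v) := (continuous_fst.tendsto _).comp hlim
  have hYlim : Tendsto (fun n => Y (θ n) 0) atTop (𝓝 x₀) := (continuous_snd.tendsto _).comp hlim
  have hv0 : 0 < v := hvmin.trans_le hv.1
  obtain ⟨K, M, -, hL, hc, hM⟩ := clampedField_regular (h := h) (κ := κ) hf hA hCc hCm v
  obtain ⟨S, hS0, hS⟩ := exists_global_solution hL hc hM 0 x₀
  have hconv : ∀ t, Tendsto (fun n => Y (θ n) t) atTop (𝓝 (S t)) := fun t =>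
    tendsto_solution hf hA hCc hCm (w := fun n => w (θ n)) hv0 hS
      (Eventually.of_forall fun n => ⟨hvmin.trans_le (hw _).1, hY _⟩) hwlim
      (by rw [hS0]; exact hYlim) t
  have hlarge : ∀ t : ℝ, ∀ᶠ n in atTop, |t| ≤ (θ n : ℝ) + 1 := fun t => by
    filter_upwards [(tendsto_natCast_atTop_atTop (R := ℝ)).comp hθ.tendsto_atTop |>.eventually
      (eventually_ge_atTop |t|)] with n hn
    simp only [Function.comp] at hn
    linarith
  have hSm : ∀ t, S t ∈ Icc (0 : ℝ) 1 := fun t =>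
    isClosed_Icc.mem_of_tendsto (hconv t) <| by
      filter_upwards [hlarge t] with n hn
      exact hYm _ t ⟨(abs_le.1 hn).1, (abs_le.1 hn).2⟩
  have hSd : ∀ t, HasDerivAt S (reducedField f A h κ v (S t) (C t)) t := fun t => by
    rw [← clampedField_of_mem (hSm t)]; exact hS t
  obtain ⟨K', -, hK'⟩ := exists_lipschitz_reducedField hf hA h κ v
  have hfslice : ∀ m ∈ Ioo (0 : ℝ) 1, ∀ c ∈ Icc (0 : ℝ) 1, ∀ l, Tendsto C l (𝓝 c) →
      Tendsto (fun t => f m (C t)) l (𝓝 (f m c)) := fun m hm c hc l hl =>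
    (hf.smooth.continuousOn (m, c) ⟨Ioo_subset_Icc_self hm, hc⟩).tendsto.comp
      (tendsto_nhdsWithin_iff.2 ⟨tendsto_const_nhds.prodMk_nhds hl,
        Eventually.of_forall fun t => ⟨Ioo_subset_Icc_self hm, hCm t⟩⟩)
  refine ⟨v, hv, S, ⟨hSm, hSd⟩, ?_, ?_⟩
  · obtain ⟨sm, hsm, h0, hb⟩ := exists_tendsto_zero_atBot hK'.continuousOn hSm hCm hcL hC.atBot hSd
      (finite_zeros_reducedField hf hA hκ hh hv0 hcL)
    rw [reducedField_eq_zero_iff hA hκ hv0 hsm hcL] at h0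
    refine ⟨sm, hsm, hb, h0, ?_⟩
    rcases (hv.2.trans hleL).lt_or_eq with hvV | rfl
    · have hpos : 0 < mL + h := by linarith [hmL.1]
      obtain ⟨v', hvv', hv'V⟩ := exists_between hvV
      have hgt : v' * (mL + h) < f mL cL := by
        rw [hmL0]; exact mul_lt_mul_of_pos_right hv'V hpos
      obtain ⟨T, hT⟩ := eventually_atBot.1
        ((hfslice mL hmL cL hcL _ hC.atBot).eventually (lt_mem_nhds hgt))
      have hlow : ∀ t ≤ T, mL ≤ S t := fun t ht => ge_of_tendsto (hconv t) <| by
        filter_upwards [hlarge t, hwlim.eventually (gt_mem_nhds hvv')] with n hn hwn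
        have hstart : Y (θ n) (-(θ n + 1)) = 1 := (hYL (θ n)).resolve_right (by linarith)
        refine ge_of_deriv_pos_at_level (hY _) (T := -((θ n : ℝ) + 1)) (b := t)
          (by rw [hstart]; exact hmL.2.le) (fun r _ hr e => ?_) t ⟨(abs_le.1 hn).1, le_rfl⟩
        rw [e, clampedField_of_mem (Ioo_subset_Icc_self hmL)]
        refine reducedField_pos hA hκ (hvmin.trans_le (hw _).1) (Ioo_subset_Icc_self hmL) (hCm r)
          ((mul_lt_mul_of_pos_right hwn hpos).trans (hT r (hr.le.trans ht)))
      have hmsm : mL ≤ sm := ge_of_tendsto hb (eventually_atBot.2 ⟨T, hlow⟩)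
      exact (hf.sShaped hcL).lt_line_after hv0 hh hmL.1.le
        ((mul_lt_mul_of_pos_right hvv' hpos).trans hgt) hmsm h0
    · exact fun z hz => (hf.sShaped hcL).lt_line_of_tangent hv0 hh hVL hsm h0 z
        ⟨hsm.1.trans hz.1.le, hz.2⟩ hz.1.ne'
  · obtain ⟨sp, hsp, h0, hb⟩ := exists_tendsto_zero_atTop hK'.continuousOn hSm hCm hcR hC.atTop hSd
      (finite_zeros_reducedField hf hA hκ hh hv0 hcR)
    rw [reducedField_eq_zero_iff hA hκ hv0 hsp hcR] at h0
    refine ⟨sp, hsp, hb, h0, ?_⟩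
    rcases (hv.2.trans hleR).lt_or_eq with hvV | rfl
    · have hpos : 0 < mR + h := by linarith [hmR.1]
      obtain ⟨v', hvv', hv'V⟩ := exists_between hvV
      have hgt : v' * (mR + h) < f mR cR := by
        rw [hmR0]; exact mul_lt_mul_of_pos_right hv'V hpos
      obtain ⟨T, hT⟩ := eventually_atTop.1
        ((hfslice mR hmR cR hcR _ hC.atTop).eventually (lt_mem_nhds hgt))
      have hup : ∀ t ≥ T, S t ≤ mR := fun t ht => le_of_tendsto (hconv t) <| by
        filter_upwards [hlarge t, hwlim.eventually (gt_mem_nhds hvv')] with n hn hwn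
        have hend : Y (θ n) (θ n + 1) = 0 := (hYR (θ n)).resolve_right (by linarith)
        -- above the level `mR` at time `t`, the solution could not reach `0`
        by_contra! hcon
        have := ge_of_deriv_pos_at_level (hY _) (T := t) (b := (θ n : ℝ) + 1) hcon.le
          (fun r hr _ e => by
            rw [e, clampedField_of_mem (Ioo_subset_Icc_self hmR)]
            refine reducedField_pos hA hκ (hvmin.trans_le (hw _).1) (Ioo_subset_Icc_self hmR)
              (hCm r) ((mul_lt_mul_of_pos_right hwn hpos).trans (hT r (ht.le.trans hr))))
          _ ⟨(abs_le.1 hn).2, le_rfl⟩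
        linarith [hmR.1]
      have hspm : sp ≤ mR := le_of_tendsto hb (eventually_atTop.2 ⟨T, hup⟩)
      exact (hf.sShaped hcR).lt_line_before hv0 hh hmR.2.le
        ((mul_lt_mul_of_pos_right hvv' hpos).trans hgt) hspm h0
    · exact fun z hz => (hf.sShaped hcR).lt_line_of_tangent hv0 hh hVR hsp h0 z
        ⟨hz.1, hz.2.le.trans hsp.2⟩ hz.2.ne

end Shooting

/-! ### Uniqueness of the velocity, and large `κ` -/

section Uniqueness

variable {f : ℝ → ℝ → ℝ} {a : ℝ → ℝ} {A : ℝ → ℝ → ℝ} {cstar cL cR h κ : ℝ} {C : ℝ → ℝ}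

theorem FlowAssumptions.pos (hf : FlowAssumptions f a cstar) {s c : ℝ} (hs : 0 < s) (hs1 : s ≤ 1)
    (hc : c ∈ Icc (0 : ℝ) 1) : 0 < f s c := by
  obtain ⟨ξ, hξ, e⟩ := (hf.sShaped hc).exists_slope le_rfl hs hs1
  have := hf.increasing ξ ⟨hξ.1, hξ.2.trans_le hs1⟩ c hc
  rw [hf.at_zero c hc, sub_zero, sub_zero] at e
  rw [← e]
  exact mul_pos this hs

theorem IsReducedWave.pos (hf : FlowAssumptions f a cstar) (hA : CapillaryAssumptions A)
    (hκ : 0 < κ) (hh : 0 < h) {v : ℝ} (hv : 0 < v) (hCm : ∀ t, C t ∈ Icc (0 : ℝ) 1) {S : ℝ → ℝ}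
    (hS : IsReducedWave f A h κ v C S) (t : ℝ) : 0 < S t := by
  refine lt_of_le_of_ne (hS.mem t).1 fun h0 => ?_
  have hmin : IsLocalMin S t := Eventually.of_forall fun r => h0 ▸ (hS.mem r).1
  have := hmin.hasDerivAt_eq_zero (hS.hasDeriv t)
  rw [reducedField_eq_zero_iff hA hκ hv (hS.mem t) (hCm t), ← h0, hf.at_zero _ (hCm t),
    zero_add] at this
  exact (mul_pos hv hh).ne this

/-- Otherwise, the connection with the smaller velocity `v₁` would start above and end below the
other one, but it can cross the other one only upwards. -/
theorem velocity_le_of_connections (hf : FlowAssumptions f a cstar) (hA : CapillaryAssumptions A)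
    (hκ : 0 < κ) (hh : 0 < h) (hCm : ∀ t, C t ∈ Icc (0 : ℝ) 1) {v₁ v₂ sm₁ sm₂ sp₁ sp₂ : ℝ}
    (hv₁ : 0 < v₁) (hv₂ : 0 < v₂) {S₁ S₂ : ℝ → ℝ}
    (hS₁ : IsReducedWave f A h κ v₁ C S₁) (hS₂ : IsReducedWave f A h κ v₂ C S₂)
    (hm₂ : sm₂ ∈ Icc (0 : ℝ) 1) (hp₂ : sp₂ ∈ Icc (0 : ℝ) 1)
    (hb₁ : Tendsto S₁ atBot (𝓝 sm₁)) (hb₂ : Tendsto S₂ atBot (𝓝 sm₂))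
    (ht₁ : Tendsto S₁ atTop (𝓝 sp₁)) (ht₂ : Tendsto S₂ atTop (𝓝 sp₂))
    (hsm₁ : f sm₁ cL = v₁ * (sm₁ + h)) (hsm₂ : f sm₂ cL = v₂ * (sm₂ + h))
    (hsp₁ : f sp₁ cR = v₁ * (sp₁ + h)) (hsp₂ : f sp₂ cR = v₂ * (sp₂ + h))
    (hlast : ∀ z ∈ Ioc sm₁ 1, f z cL < v₁ * (z + h))
    (hfirst : ∀ z ∈ Ico 0 sp₁, f z cR < v₁ * (z + h)) : v₂ ≤ v₁ := by
  by_contra! hlt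
  have hm : sm₂ < sm₁ := by
    have h1 := mul_lt_mul_of_pos_right hlt (show 0 < sm₂ + h by linarith [hm₂.1])
    by_contra! hle
    rcases hle.eq_or_lt with rfl | hlt'
    · linarith
    · linarith [hlast sm₂ ⟨hlt', hm₂.2⟩]
  have hp : sp₁ < sp₂ := by
    have h1 := mul_lt_mul_of_pos_right hlt (show 0 < sp₂ + h by linarith [hp₂.1])
    by_contra! hle
    rcases hle.eq_or_lt with rfl | hlt'
    · linarith
    · linarith [hfirst sp₂ ⟨hp₂.1, hlt'⟩]
  obtain ⟨T, hT⟩ := ((hb₂.sub hb₁).eventually (gt_mem_nhds (sub_neg.2 hm))).exists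
  obtain ⟨T', hT', hTT'⟩ := (((ht₂.sub ht₁).eventually (lt_mem_nhds (sub_pos.2 hp))).and
    (eventually_ge_atTop T)).exists
  have := le_of_deriv_neg_at_level (fun t => (hS₂.hasDeriv t).sub (hS₁.hasDeriv t)) (l := 0)
    (T := T) (b := T') hT.le (fun t _ _ ht => ?_) T' ⟨hTT', le_rfl⟩
  · simp only [Pi.sub_apply] at this
    linarith
  · have hs : S₂ t = S₁ t := sub_eq_zero.1 ht
    have hpos := hS₁.pos hf hA hκ hh hv₁ hCm t
    have hfpos := hf.pos hpos (hS₁.mem t).2 (hCm t)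
    have hAp := hA.pos (hS₁.mem t) (hCm t)
    rw [hs]
    have e : reducedField f A h κ v₂ (S₁ t) (C t) - reducedField f A h κ v₁ (S₁ t) (C t)
        = κ * f (S₁ t) (C t) / A (S₁ t) (C t) * (v₂⁻¹ - v₁⁻¹) := by
      unfold reducedField
      field_simp
      ring
    rw [e]
    exact mul_neg_of_pos_of_neg (by positivity)
      (sub_neg.2 ((inv_lt_inv₀ hv₂ hv₁).2 hlt))

/-- If the line `v (s + h)` lies above the graph of `f(·, C 0)`, a wave of velocity `v` falls by an
amount proportional to `κ` in a time independent of `κ`, so that it leaves `[0,1]` for large `κ`. -/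
theorem exists_kappa_bound (hf : FlowAssumptions f a cstar) (hA : CapillaryAssumptions A)
    (hCc : Continuous C) (hCm : ∀ t, C t ∈ Icc (0 : ℝ) 1) {v : ℝ} (hv : 0 < v)
    (hneg : ∀ s ∈ Icc (0 : ℝ) 1, f s (C 0) < v * (s + h)) :
    ∃ κ₀ : ℝ, 0 ≤ κ₀ ∧ ∀ κ, κ₀ < κ → ∀ S, ¬ IsReducedWave f A h κ v C S := by
  obtain ⟨⟨α, β, hα, hAα⟩, -⟩ := id hA
  have hβ : 0 < β := hα.trans_le ((hAα 0 (by simp) 0 (by simp)).1.trans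
    (hAα 0 (by simp) 0 (by simp)).2)
  obtain ⟨sx, hsx, hmax⟩ := isCompact_Icc.exists_isMaxOn (f := fun s => f s (C 0) - v * (s + h))
    (nonempty_Icc.2 zero_le_one) ((hf.sShaped (hCm 0)).continuousOn.sub (by fun_prop))
  obtain ⟨δ, hδ, hδe⟩ : ∃ δ, 0 < δ ∧ f sx (C 0) - v * (sx + h) = -(2 * δ) :=
    ⟨-(f sx (C 0) - v * (sx + h)) / 2, by linarith [hneg sx hsx], by ring⟩
  obtain ⟨Kf, hKf⟩ := hf.smooth.exists_lipschitzOnWith (by norm_num)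
    ((convex_Icc _ _).prod (convex_Icc _ _)) (isCompact_Icc.prod isCompact_Icc)
  have hlim : Tendsto (fun t => Kf * |C t - C 0|) (𝓝 0) (𝓝 0) := by
    have : Continuous fun t => (Kf : ℝ) * |C t - C 0| := by fun_prop
    simpa using this.tendsto 0
  obtain ⟨η, hη, hηb⟩ := Metric.eventually_nhds_iff.1 (hlim.eventually (gt_mem_nhds hδ))
  have hbound : ∀ t ∈ Ioo 0 (η / 2), ∀ s ∈ Icc (0 : ℝ) 1, f s (C t) - v * (s + h) ≤ -δ := by
    intro t ht s hs
    have h1 := hKf.dist_le_mul (s, C t) ⟨hs, hCm t⟩ (s, C 0) ⟨hs, hCm 0⟩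
    rw [Prod.dist_eq, dist_self, max_eq_right dist_nonneg, Real.dist_eq, Real.dist_eq] at h1
    have h2 := hηb (y := t) (by
      rw [Real.dist_eq, sub_zero, abs_of_pos ht.1]; linarith [ht.2])
    have h3 : f s (C 0) - v * (s + h) ≤ f sx (C 0) - v * (sx + h) := hmax hs
    have h4 := (le_abs_self _).trans h1
    simp only at h4
    linarith
  refine ⟨2 * (v * β) / (δ * η), by positivity, fun κ hκ S hS => ?_⟩
  have hκ0 : 0 < κ := lt_of_le_of_lt (by positivity) hκ
  obtain ⟨t, ht, e⟩ := exists_hasDerivAt_eq_slope S _ (half_pos hη)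
    (fun t _ => (hS.hasDeriv t).continuousAt.continuousWithinAt) (fun t _ => hS.hasDeriv t)
  have h1 := hbound t ht (S t) (hS.mem t)
  have hAp := hA.pos (hS.mem t) (hCm t)
  rw [sub_zero, eq_div_iff (half_pos hη).ne', reducedField, div_mul_eq_mul_div,
    div_eq_iff (mul_pos hv hAp).ne'] at e
  have h2 : -1 ≤ S (η / 2) - S 0 := by linarith [(hS.mem (η / 2)).1, (hS.mem 0).2]
  have h3 : v * A (S t) (C t) ≤ v * β :=
    mul_le_mul_of_nonneg_left (hAα _ (hS.mem t) _ (hCm t)).2 hv.le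
  have h4 : -(v * β) ≤ (S (η / 2) - S 0) * (v * A (S t) (C t)) := by
    nlinarith [mul_pos hv hAp]
  have h5 : κ * (f (S t) (C t) - v * (S t + h)) * (η / 2) ≤ κ * (-δ) * (η / 2) := by gcongr
  rw [div_lt_iff₀ (by positivity)] at hκ
  linarith

end Uniqueness

/-! ### Configuration of characteristic speeds -/

section Configuration

variable {f : ℝ → ℝ → ℝ} {a : ℝ → ℝ} {cL cR h v sm sp : ℝ}

theorem lt_lamC_of_line (hv : 0 < v) (hs : 0 < sm) (h0 : f sm cL = v * (sm + h))
    (hd0 : 0 ≤ dA a cL) (hd : dA a cL < h) : v < lamC f a sm cL := by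
  rw [lamC, h0, lt_div_iff₀ (by linarith)]
  exact mul_lt_mul_of_pos_left (by linarith) hv

theorem lamC_lt_of_line (hv : 0 < v) (hs : 0 < sp) (h0 : f sp cR = v * (sp + h)) (hh : 0 < h)
    (hd : h < dA a cR) : lamC f a sp cR < v := by
  rw [lamC, h0, div_lt_iff₀ (by linarith)]
  exact mul_lt_mul_of_pos_left (by linarith) hv

/-- As `λ^c > v` at the left and `λ^c < v` at the right state, the configuration is decided by
`f_s`. -/
theorem isCrossingOrSonic_iff (hm : v < lamC f a sm cL) (hp : lamC f a sp cR < v) :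
    IsCrossingOrSonic f a sm cL sp cR v ↔ dS f sm cL ≤ v ∧ v ≤ dS f sp cR := by
  simp only [IsCrossingOrSonic, lam1, lam2, lamS, min_le_iff, lt_max_iff, min_lt_iff, le_max_iff,
    hm, hp, not_le.2 hm, not_le.2 hp, or_true, or_false, and_true, true_and]

theorem isCrossing_iff (hm : v < lamC f a sm cL) (hp : lamC f a sp cR < v) :
    IsCrossing f a sm cL sp cR v ↔ dS f sm cL < v ∧ v < dS f sp cR := by
  simp only [IsCrossing, lam1, lam2, lamS, lt_max_iff, min_lt_iff,
    hm, hp, not_lt.2 hm.le, not_lt.2 hp.le, or_true, or_false, and_true, true_and]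

end Configuration

end ChemFlood

theorem mainTheorem9 (f : ℝ → ℝ → ℝ) (a : ℝ → ℝ) (A : ℝ → ℝ → ℝ) (cstar cL cR : ℝ)
    (hf : ChemFlood.FlowAssumptions f a cstar) (ha : ChemFlood.AdsorptionAssumptions a)
    (hA : ChemFlood.CapillaryAssumptions A)
    (hcL : cL ∈ Set.Icc (0 : ℝ) 1) (hcR : cR ∈ Set.Icc (0 : ℝ) 1)
    (hLstar : cstar < cL) (hRstar : cR < cstar) :
    ∃ vmin vmax κ₀ : ℝ, 0 < vmin ∧ vmin < vmax ∧ 0 ≤ κ₀ ∧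
      ∀ κ : ℝ, 0 < κ →
        ∃ sm ∈ Set.Icc (0 : ℝ) 1, ∃ sp ∈ Set.Icc (0 : ℝ) 1, ∃ v ∈ Set.Icc vmin vmax,
          -- an admissible `c`-shock of crossing configuration
          ChemFlood.IsAdmissibleShock f a A κ sm cL sp cR v ∧
          ChemFlood.IsCrossingOrSonic f a sm cL sp cR v ∧
          (v < vmax → ChemFlood.IsCrossing f a sm cL sp cR v) ∧
          (κ₀ < κ → v < vmax) ∧
          -- it is unique
          (∀ sm' ∈ Set.Icc (0 : ℝ) 1, ∀ sp' ∈ Set.Icc (0 : ℝ) 1, ∀ v' ∈ Set.Icc vmin vmax,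
            ChemFlood.IsAdmissibleShock f a A κ sm' cL sp' cR v' →
            ChemFlood.IsCrossingOrSonic f a sm' cL sp' cR v' →
            sm' = sm ∧ sp' = sp ∧ v' = v) ∧
          -- the critical values exist, and the wave sequence is compatible by speed
          (∃! K, ChemFlood.IsCriticalShockValue f (ChemFlood.chordSlope a cL cR) v sm cL K) ∧
          (∃! K, ChemFlood.IsCriticalShockValue f (ChemFlood.chordSlope a cL cR) v sp cR K) ∧
          ∀ Km Kp : ℝ,
            ChemFlood.IsCriticalShockValue f (ChemFlood.chordSlope a cL cR) v sm cL Km →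
            ChemFlood.IsCriticalShockValue f (ChemFlood.chordSlope a cL cR) v sp cR Kp →
            ∀ sL ∈ Set.Icc Km 1, ∀ sR ∈ Set.Icc 0 Kp,
              ChemFlood.CompatibleBySpeed f a A κ cL cR sL sm sp sR v := by
  have hlt : cR < cL := hRstar.trans hLstar
  have hst : cstar ∈ Set.Icc (0 : ℝ) 1 := Set.Ioo_subset_Icc_self hf.cstar_mem
  obtain ⟨hh, hdL, hdR⟩ := ha.slopes hcL.2 hcR.1 hlt
  set h := ChemFlood.chordSlope a cL cR with hhdef
  obtain ⟨V₀, hV₀, hV₀1, hV₀max, s₀, hs₀, hs₀e⟩ := (hf.sShaped hst).exists_max_slope hh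
  obtain ⟨VL, -, -, hVL, mL, hmL, hmLe⟩ := (hf.sShaped hcL).exists_max_slope hh
  obtain ⟨VR, -, -, hVR, mR, hmR, hmRe⟩ := (hf.sShaped hcR).exists_max_slope hh
  have hs₀h : 0 < s₀ + h := by linarith [hs₀.1]
  have h1h : 0 < 1 + h := by linarith
  have hV₀L : V₀ < VL := by
    refine lt_of_mul_lt_mul_right ?_ hs₀h.le
    linarith [hVL s₀ (Set.Ioo_subset_Icc_self hs₀), hf.lt_of_ne hs₀ hcL hLstar.ne']
  have hV₀R : V₀ < VR := by
    refine lt_of_mul_lt_mul_right ?_ hs₀h.le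
    linarith [hVR s₀ (Set.Ioo_subset_Icc_self hs₀), hf.lt_of_ne hs₀ hcR hRstar.ne]
  -- a lower bound for which the line `v (s + h)` still cuts all graphs, and passes above `(1, 1)`
  obtain ⟨vmin, hvmin1, hvmin₀⟩ := exists_between ((div_lt_iff₀ h1h).2 hV₀1)
  have hvmin : 0 < vmin := (by positivity : (0 : ℝ) < 1 / (1 + h)).trans hvmin1
  rw [div_lt_iff₀ h1h] at hvmin1
  set vmax := min VL VR with hvmax
  have hV₀max' : V₀ < vmax := lt_min hV₀L hV₀R
  have hminmax : vmin < vmax := hvmin₀.trans hV₀max'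
  obtain ⟨C, hC, hC0⟩ := ChemFlood.exists_concentrationProfile ha hcL.2 hcR.1
    (c₀ := cstar) ⟨hRstar, hLstar⟩
  have hCm : ∀ t, C t ∈ Set.Icc (0 : ℝ) 1 := fun t =>
    ⟨by linarith [(hC.mem t).1, hcR.1], by linarith [(hC.mem t).2, hcL.2]⟩
  have hCc : Continuous C := continuous_iff_continuousAt.2 fun t => (hC.hasDeriv t).continuousAt
  obtain ⟨κ₀, hκ₀, hlarge⟩ := ChemFlood.exists_kappa_bound (h := h) (v := vmax) hf hA hCc hCm
    (hV₀.trans hV₀max') (fun s hs => by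
      rw [hC0]
      exact (hV₀max s hs).trans_lt (mul_lt_mul_of_pos_right hV₀max' (by linarith [hs.1])))
  refine ⟨vmin, vmax, κ₀, hvmin, hminmax, hκ₀, fun κ hκ => ?_⟩
  have hbar : ∀ c ∈ Set.Icc (0 : ℝ) 1, vmin * (s₀ + h) < f s₀ c := fun c hc => by
    have h1 : vmin * (s₀ + h) < f s₀ cstar := hs₀e ▸ mul_lt_mul_of_pos_right hvmin₀ hs₀h
    rcases eq_or_ne c cstar with rfl | hne
    · exact h1
    · exact h1.trans (hf.lt_of_ne hs₀ hc hne)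
  obtain ⟨v, hv, S, hS, ⟨sm, hsm, hSb, hsm0, hlast⟩, sp, hsp, hSt, hsp0, hfirst⟩ :=
    ChemFlood.exists_connection hf hA hcL hcR hC hκ hh hvmin hminmax hvmin1 hs₀ hbar hVL hmL hmLe
      hVR hmR hmRe (min_le_left _ _) (min_le_right _ _)
      ((min_choice VL VR).imp id id)
  have hv0 : 0 < v := hvmin.trans_le hv.1
  have hv1 : 1 < v * (1 + h) := hvmin1.trans_le (mul_le_mul_of_nonneg_right hv.1 h1h.le)
  have hφL := hf.sShaped hcL
  have hφR := hf.sShaped hcR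
  have hsmI : sm ∈ Set.Ioo (0 : ℝ) 1 :=
    ⟨hφL.pos_of_line hv0 hh hsm.1 hsm0, hφL.lt_one_of_line hv1 hsm.2 hsm0⟩
  have hspI : sp ∈ Set.Ioo (0 : ℝ) 1 :=
    ⟨hφR.pos_of_line hv0 hh hsp.1 hsp0, hφR.lt_one_of_line hv1 hsp.2 hsp0⟩
  have hlamL := ChemFlood.lt_lamC_of_line hv0 hsmI.1 hsm0 ha.dA_nonneg hdL
  have hlamR := ChemFlood.lamC_lt_of_line hv0 hspI.1 hsp0 hh hdR
  have hdm := hφL.deriv_le_of_last hsmI hsm0 hlast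
  have hdp := hφR.le_deriv_of_first hspI hsp0 hfirst
  refine ⟨sm, hsm, sp, hsp, v, hv,
    ChemFlood.isAdmissibleShock_of_reducedWave hf ha hA hκ hv0 hcL.2 hcR.1 hlt hC hS hSb hSt hsm0
      hsp0,
    (ChemFlood.isCrossingOrSonic_iff hlamL hlamR).2 ⟨hdm, hdp⟩, fun hvlt => ?_, fun hκκ => ?_,
    fun sm' hsm' sp' hsp' v' hv' hadm hcr => ?_,
    ChemFlood.existsUnique_isCriticalShockValue hf hcL hv0 hh hsm hsm0,
    ChemFlood.existsUnique_isCriticalShockValue hf hcR hv0 hh hsp hsp0,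
    fun Km Kp hKm hKp sL hsL sR hsR => ChemFlood.compatibleBySpeed hf ha hA hκ hcL hcR hv0 hh hsm
      hsp hsm0 hsp0 hlast hfirst hdm hdp hKm hKp hsL hsR⟩
  · refine (ChemFlood.isCrossing_iff hlamL hlamR).2 ⟨?_, ?_⟩
    · exact hφL.deriv_lt_of_last hv0 hh hsmI hsm0 hlast (Set.Ioo_subset_Icc_self hmL)
        (hmLe ▸ mul_lt_mul_of_pos_right (hvlt.trans_le (min_le_left _ _))
          (by linarith [hmL.1]))
    · exact hφR.lt_deriv_of_first hv0 hh hspI hsp0 hfirst (Set.Ioo_subset_Icc_self hmR)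
        (hmRe ▸ mul_lt_mul_of_pos_right (hvlt.trans_le (min_le_right _ _))
          (by linarith [hmR.1]))
  · refine lt_of_le_of_ne hv.2 ?_
    rintro rfl
    exact hlarge κ hκκ S hS
  · have hv'0 : 0 < v' := hvmin.trans_le hv'.1
    obtain ⟨S', hS', hSb', hSt'⟩ := ChemFlood.exists_reducedWave_of_isAdmissibleShock hf ha hA hκ
      hv'0 hcL hcR hlt hC hsm' hadm
    obtain ⟨hsm0', hsp0'⟩ := (ChemFlood.rankineHugoniot_iff hlt).1 hadm.2.1
    have hlamL' := ChemFlood.lt_lamC_of_line hv'0 (hφL.pos_of_line hv'0 hh hsm'.1 hsm0') hsm0'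
      ha.dA_nonneg hdL
    have hlamR' := ChemFlood.lamC_lt_of_line hv'0 (hφR.pos_of_line hv'0 hh hsp'.1 hsp0') hsp0'
      hh hdR
    obtain ⟨hdm', hdp'⟩ := (ChemFlood.isCrossingOrSonic_iff hlamL' hlamR').1 hcr
    have hlast' := hφL.lt_line_of_deriv_le hv'0 hh hsm'.1 hsm0' hdm'
    have hfirst' := hφR.lt_line_of_le_deriv hv'0 hh hsp'.2 hsp0' hdp'
    have hvv : v' = v := le_antisymm
      (ChemFlood.velocity_le_of_connections hf hA hκ hh hCm hv0 hv'0 hS hS' hsm' hsp' hSb hSb' hSt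
        hSt' hsm0 hsm0' hsp0 hsp0' hlast hfirst)
      (ChemFlood.velocity_le_of_connections hf hA hκ hh hCm hv'0 hv0 hS' hS hsm hsp hSb' hSb hSt'
        hSt hsm0' hsm0 hsp0' hsp0 hlast' hfirst')
    subst hvv
    refine ⟨?_, ?_, rfl⟩
    · rcases lt_trichotomy sm' sm with hl | he | hl
      · exact absurd hsm0 (hlast' sm ⟨hl, hsm.2⟩).ne
      · exact he
      · exact absurd hsm0' (hlast sm' ⟨hl, hsm'.2⟩).ne
    · rcases lt_trichotomy sp' sp with hl | he | hl
      · exact absurd hsp0' (hfirst sp' ⟨hsp'.1, hl⟩).ne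
      · exact he
      · exact absurd hsp0 (hfirst' sp ⟨hsp.1, hl⟩).ne
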